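/- Let $M$ be a smooth $2$-dimensional manifold with a Möbius structure: a conformal class of Riemannian metrics together with, for each metric $g_{ab}$ in the class, a smooth symmetric tensor $\mathrm{P}_{ab}$ such that, whenever $\widehat g_{ab}=\Omega^2g_{ab}$ with $\Omega>0$ smooth, $\widehat{\mathrm P}_{ab}=\mathrm P_{ab}-\nabla_a\Upsilon_b+\Upsilon_a\Upsilon_b-\tfrac12\Upsilon^c\Upsilon_c\,g_{ab}$, where $\Upsilon_a=\Omega^{-1}\nabla_a\Omega$ and $\nabla$ is the Levi-Civita connection of $g$. In a metric $g$ of the class, an adjoint tractor of weight $w$ (an element of $\mathcal A[w]$) is a quadruple $(\sigma_b,\mu_{bc},\nu,\rho_b)$ with $\mu_{bc}=-\mu_{cb}$; on replacing $g$ by $\Omega^2g$ it becomes $\Omega^w$ times $$\big(\Omega^2\sigma_b,\ \Omega^2(\mu_{bc}+2\Upsilon_{[b}\sigma_{c]}),\ \nu+\Upsilon^b\sigma_b,\ \rho_b+\Upsilon^a\mu_{ab}-\Upsilon_b\nu-\Upsilon^a\Upsilon_b\sigma_a+\tfrac12\Upsilon^a\Upsilon_a\sigma_b\big)$$ (indices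 raised with $g$; $\mathcal A=\mathcal A[0]$). Let $\gamma$ be a smooth oriented immersed curve in $M$, given by a parametrization with nowhere vanishing velocity on an open set $I\subset\mathbb R$, for instance an open interval. For each $g$ in the class let $U^a$ be its unit tangent vector and let $\partial=U^a\nabla_a$. Put $A_a=\partial U_a$ and let $J_a=\partial A_a+(A^bA_b+\mathrm P_{bc}U^bU^c)U_a-\mathrm P_{ab}U^b$ be the normalised jerk. The adjoint tractor connection along $\gamma$ is, in the metric $g$, $$\partial(\sigma_b,\mu_{bc},\nu,\rho_b)=\big(\partial\sigma_b-U^a\mu_{ab}-\nu U_b,\ \partial\mu_{bc}-2U_{[b}\rho_{c]}+2U^a\mathrm P_{a[b}\sigma_{c]},\ \partial\nu+U^a\rho_a+U^a\mathrm P_a{}^b\sigma_b,\ \partial\rho_b-U^a\mathrm P_a{}^c\mu_{bc}-U^a\mathrm P_{ab}\nu\big),$$ and it takes sections of $\mathcal A$ along $\gamma$ to sections of $\mathcal A[-1]$. **Theorem.** Suppose that $J_b$ vanishes nowhere along $\gamma$ (for one, equivalently for every, metric of the class). Then for every $g$ in the class there is exactly one function $\kappa=\kappa_g$ along $\gamma$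 with $$\partial J_b+A^cJ_cU_b+2\kappa J_b=0,$$ and it is smooth. The quadruples $$\big(U_b,\ 2U_{[b}A_{c]},\ \kappa,\ J_b+\tfrac12(A^cA_c-\kappa^2)U_b+\kappa A_b\big)$$ define a section of $\mathcal A[-1]$ along $\gamma$, and hence their multiples form an invariantly defined line subbundle of $\mathcal A$ (and of each $\mathcal A[w]$) along $\gamma$. The function $$\partial\kappa+\tfrac12(A^aA_a+\kappa^2)+U^aU^b\mathrm P_{ab}$$ is an invariant density of weight $-2$ along $\gamma$: it is multiplied by $\Omega^{-2}$ when $g$ is replaced by $\Omega^2g$. For every metric $g$ in the class, the line subbundle is preserved by $\partial$ (that is, $\partial$ takes its smooth sections to sections of the corresponding line subbundle of $\mathcal A[-1]$) if and only if $$\partial\kappa+\tfrac12(A^aA_a+\kappa^2)+U^aU^b\mathrm P_{ab}=0\quad\text{along }\gamma.$$ (Curves satisfying this equation are called ordinal conformal loxodromes.) -/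

import Mathlib

set_option maxSynthPendingDepth 3

open scoped Manifold ContDiff

noncomputable section

namespace Mobius

/-- The model space of a surface. -/
abbrev Plane : Type := EuclideanSpace ℝ (Fin 2)

section Surface

variable {M : Type*} [TopologicalSpace M] [ChartedSpace Plane M]

/-- Covectors at `x`. -/
abbrev Covector (x : M) : Type := TangentSpace (𝓡 2) x →L[ℝ] ℝ

/-- Bilinear forms on the tangent space at `x`. -/
abbrev BilinForm (x : M) : Type := TangentSpace (𝓡 2) x →L[ℝ] TangentSpace (𝓡 2) x →L[ℝ] ℝ

/-- Skew bilinear forms on the tangent space at `x`. -/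
def TwoForm (x : M) : Submodule ℝ (BilinForm x) where
  carrier := {μ | ∀ v, μ v v = 0}
  add_mem' := by
    intro a b ha hb v
    simp [ha v, hb v]
  zero_mem' := by
    intro v
    simp
  smul_mem' := by
    intro r a ha v
    simp [ha v]

/-- `α_b β_c - α_c β_b = 2 α_[b β_c]`. -/
def wedge {x : M} (α β : Covector x) : TwoForm x :=
  ⟨α.smulRight β - β.smulRight α, by
    intro v
    simp [mul_comm]⟩

lemma wedge_add {x : M} (α β β' : Covector x) : wedge α (β + β') = wedge α β + wedge α β' := by
  ext v w
  simp [wedge]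
  ring

lemma wedge_smul {x : M} (r : ℝ) (α β : Covector x) : wedge α (r • β) = r • wedge α β := by
  ext v w
  simp [wedge]
  ring

lemma TwoForm.skew {x : M} (μ : TwoForm x) (a b : TangentSpace (𝓡 2) x) :
    μ.1 a b + μ.1 b a = 0 := by
  have h := μ.2 (a + b)
  have ha := μ.2 a
  have hb := μ.2 b
  simp only [map_add, add_apply] at h
  linarith

variable [IsManifold (𝓡 2) ∞ M]

variable (M) in
/-- Smooth Riemannian metrics on `M`. -/
abbrev Metric : Type _ :=
  Bundle.ContMDiffRiemannianMetric (𝓡 2) ∞ Plane (fun x : M => TangentSpace (𝓡 2) x)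

/-! ### Local coordinates

`x₀` selects the chart `extChartAt (𝓡 2) x₀` around `x₀`. -/

/-- The coordinate frame at `x` of the chart around `x₀`. -/
def frame (x₀ x : M) : Plane →L[ℝ] TangentSpace (𝓡 2) x :=
  (trivializationAt Plane (fun y : M => TangentSpace (𝓡 2) y) x₀).symmL ℝ x

/-- The components of a tangent vector at `x` in the chart around `x₀`. -/
def coframe (x₀ x : M) : TangentSpace (𝓡 2) x →L[ℝ] Plane :=
  (trivializationAt Plane (fun y : M => TangentSpace (𝓡 2) y) x₀).continuousLinearMapAt ℝ x

/-- The components of a covector at `x` in the chart around `x₀`. -/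
def covectorCoords (x₀ x : M) (α : Covector x) : Plane →L[ℝ] ℝ := α ∘L frame x₀ x

/-- The components of a bilinear form at `x` in the chart around `x₀`. -/
def bilinCoords (x₀ x : M) (B : BilinForm x) : Plane →L[ℝ] Plane →L[ℝ] ℝ :=
  (ContinuousLinearMap.precomp ℝ (frame x₀ x)) ∘L B ∘L frame x₀ x

/-- The components of the metric in the chart around `x₀`, as a function of the coordinates. -/
def metricCoords (g : Metric M) (x₀ : M) (y : Plane) : Plane →L[ℝ] Plane →L[ℝ] ℝ :=
  bilinCoords x₀ ((extChartAt (𝓡 2) x₀).symm y) (g.inner ((extChartAt (𝓡 2) x₀).symm y))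

/-- The Christoffel symbols of the first kind at `x₀`, in the chart around `x₀`:
`Γ(u)(v)(w) = ½ (D_u g(v,w) + D_v g(u,w) - D_w g(u,v))`. -/
def christoffelFirst (g : Metric M) (x₀ : M) (u : Plane) : Plane →L[ℝ] Plane →L[ℝ] ℝ :=
  let Dg : Plane →L[ℝ] Plane →L[ℝ] Plane →L[ℝ] ℝ :=
    fderiv ℝ (metricCoords g x₀) (extChartAt (𝓡 2) x₀ x₀)
  (1 / 2 : ℝ) • (Dg u + Dg.flip u - (Dg.flip u).flip)

/-- The Christoffel symbols of the Levi-Civita connection at `x₀`, in the chart around `x₀`, so that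
`∇_u v = D_u v + Γ(u)(v)`. -/
def christoffel (g : Metric M) (x₀ : M) (u : Plane) : Plane →L[ℝ] Plane :=
  (metricCoords g x₀ (extChartAt (𝓡 2) x₀ x₀)).inverse ∘L christoffelFirst g x₀ u

/-- The Levi-Civita derivative of a 1-form: `nablaForm g α x u v = u^a v^b ∇_a α_b` at `x`. -/
def nablaForm (g : Metric M) (α : ∀ x : M, Covector x) (x : M) (u v : TangentSpace (𝓡 2) x) : ℝ :=
  fderiv ℝ (fun y : Plane => covectorCoords x ((extChartAt (𝓡 2) x).symm y)
      (α ((extChartAt (𝓡 2) x).symm y))) (extChartAt (𝓡 2) x x) (coframe x x u) (coframe x x v)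
    - α x (frame x x (christoffel g x (coframe x x u) (coframe x x v)))

/-! ### Algebra of a metric -/

/-- Lowering an index. -/
def flat (g : Metric M) {x : M} (v : TangentSpace (𝓡 2) x) : Covector x := g.inner x v

/-- Raising an index. -/
def sharp (g : Metric M) {x : M} (α : Covector x) : TangentSpace (𝓡 2) x :=
  (g.inner x).inverse α

/-- The inner product `α^a β_a` of covectors. -/
def cometric (g : Metric M) {x : M} (α β : Covector x) : ℝ := β (sharp g α)

/-! ### Conformal rescaling and Möbius structures -/

/-- `g' = Ω² g` for a smooth positive function `Ω`. -/
structure IsRescaling (g g' : Metric M) (Ω : M → ℝ) : Prop where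
  smooth : ContMDiff (𝓡 2) 𝓘(ℝ, ℝ) ∞ Ω
  pos : ∀ x, 0 < Ω x
  eq : ∀ (x : M) (v w : TangentSpace (𝓡 2) x), g'.inner x v w = Ω x ^ 2 * g.inner x v w

/-- The 1-form `Υ = Ω⁻¹ dΩ`. -/
def upsilon (Ω : M → ℝ) (x : M) : Covector x := (Ω x)⁻¹ • mvfderiv (𝓡 2) Ω x

variable (M) in
/-- A Möbius structure on a surface: a conformal class of Riemannian metrics and, for each metric
`g` of the class, a smooth symmetric tensor `P` (the Rho-tensor), such that the Rho-tensors of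
`g` and `Ω² g` are related by
`P'_ab = P_ab - ∇_a Υ_b + Υ_a Υ_b - ½ Υ^c Υ_c g_ab`. -/
structure MobiusStructure where
  metrics : Set (Metric M)
  nonempty : metrics.Nonempty
  mem_iff : ∀ g ∈ metrics, ∀ g' : Metric M, g' ∈ metrics ↔ ∃ Ω : M → ℝ, IsRescaling g g' Ω
  rho : metrics → ∀ x : M, BilinForm x
  rho_smooth : ∀ g, ContMDiff (𝓡 2) ((𝓡 2).prod 𝓘(ℝ, Plane →L[ℝ] Plane →L[ℝ] ℝ)) ∞
    (fun x : M => Bundle.TotalSpace.mk' (Plane →L[ℝ] Plane →L[ℝ] ℝ)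
      (E := fun x : M => BilinForm x) x (rho g x))
  rho_symm : ∀ g (x : M) (v w : TangentSpace (𝓡 2) x), rho g x v w = rho g x w v
  rho_rescale : ∀ (g g' : metrics) (Ω : M → ℝ), IsRescaling g.1 g'.1 Ω →
    ∀ (x : M) (v w : TangentSpace (𝓡 2) x),
      rho g' x v w = rho g x v w - nablaForm g.1 (upsilon Ω) x v w
        + upsilon Ω x v * upsilon Ω x w
        - 1 / 2 * cometric g.1 (upsilon Ω x) (upsilon Ω x) * g.1.inner x v w

/-! ### Weighted densities and adjoint tractors at a point -/

/-- Densities of weight `w` at `x`: a real number for each metric of the class, multiplied by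
`Ω(x)^w` when `g` is replaced by `Ω² g`. -/
def IsDensity (c : MobiusStructure M) (w : ℤ) (x : M) (f : c.metrics → ℝ) : Prop :=
  ∀ (g g' : c.metrics) (Ω : M → ℝ), IsRescaling g.1 g'.1 Ω → f g' = Ω x ^ w * f g

/-- An adjoint tractor at `x` as seen in a metric `g`: the quadruple `(σ_b, μ_bc, ν, ρ_b)`. Here
`σ_b` and `μ_bc` have conformal weight `2`, and `g` serves to view them as an unweighted covector
and an unweighted 2-form. -/
abbrev TractorInScale (x : M) : Type := Covector x × TwoForm x × ℝ × Covector x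

/-- The change of an adjoint tractor when `g` is replaced by `Ω² g`. All indices are raised with
`g`, and the factors `Ω²` account for the weights of `σ_b` and `μ_bc`. -/
def rescale (g : Metric M) (Ω : M → ℝ) (x : M) (s : TractorInScale x) : TractorInScale x :=
  let Υ : Covector x := upsilon Ω x
  (Ω x ^ 2 • s.1,
   Ω x ^ 2 • (s.2.1 + wedge Υ s.1),
   s.2.2.1 + cometric g Υ s.1,
   s.2.2.2 + s.2.1.1 (sharp g Υ) - s.2.2.1 • Υ - cometric g Υ s.1 • Υ
     + (1 / 2 * cometric g Υ Υ) • s.1)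

lemma cometric_add (g : Metric M) {x : M} (α β β' : Covector x) :
    cometric g α (β + β') = cometric g α β + cometric g α β' := rfl

lemma cometric_smul (g : Metric M) {x : M} (r : ℝ) (α β : Covector x) :
    cometric g α (r • β) = r * cometric g α β := rfl

lemma rescale_add (g : Metric M) (Ω : M → ℝ) (x : M) (s s' : TractorInScale x) :
    rescale g Ω x (s + s') = rescale g Ω x s + rescale g Ω x s' := by
  refine Prod.ext ?_ (Prod.ext ?_ (Prod.ext ?_ ?_))
  · simp [rescale]
  · simp only [rescale, Prod.fst_add, Prod.snd_add, wedge_add]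
    module
  · simp only [rescale, Prod.fst_add, Prod.snd_add, cometric_add]
    ring
  · simp only [rescale, Prod.fst_add, Prod.snd_add, cometric_add, Submodule.coe_add,
      add_apply]
    module

lemma rescale_smul (g : Metric M) (Ω : M → ℝ) (x : M) (r : ℝ) (s : TractorInScale x) :
    rescale g Ω x (r • s) = r • rescale g Ω x s := by
  refine Prod.ext ?_ (Prod.ext ?_ (Prod.ext ?_ ?_))
  · simp only [rescale, Prod.smul_fst]
    module
  · simp only [rescale, Prod.smul_fst, Prod.smul_snd, wedge_smul]
    module
  · simp only [rescale, Prod.smul_fst, Prod.smul_snd, cometric_smul, smul_eq_mul]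
    ring
  · simp only [rescale, Prod.smul_fst, Prod.smul_snd, cometric_smul, Submodule.coe_smul,
      smul_apply, smul_eq_mul]
    module

/-- The fibre at `x` of the weighted adjoint tractor bundle `𝒜[w]`: a quadruple for each metric of
the class, related by `rescale`, with the additional factor `Ω(x)^w`. -/
def AdjointTractor (c : MobiusStructure M) (w : ℤ) (x : M) :
    Submodule ℝ (c.metrics → TractorInScale x) where
  carrier := {s | ∀ (g g' : c.metrics) (Ω : M → ℝ), IsRescaling g.1 g'.1 Ω →
    s g' = Ω x ^ w • rescale g.1 Ω x (s g)}
  add_mem' := by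
    intro a b ha hb g g' Ω h
    simp only [Pi.add_apply, ha g g' Ω h, hb g g' Ω h, rescale_add, smul_add]
  zero_mem' := by
    intro g g' Ω h
    have h0 : rescale g.1 Ω x (0 : TractorInScale x) = 0 := by
      have := rescale_smul g.1 Ω x (0 : ℝ) 0
      simpa using this
    simp [h0]
  smul_mem' := by
    intro r a ha g g' Ω h
    simp only [Pi.smul_apply, ha g g' Ω h, rescale_smul]
    rw [smul_comm]

/-! ### Derivatives along a curve -/

/-- The velocity of a parametrized curve. -/
def velocity (γ : ℝ → M) (t : ℝ) : TangentSpace (𝓡 2) (γ t) :=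
  mfderiv 𝓘(ℝ, ℝ) (𝓡 2) γ t (1 : ℝ)

/-- The speed of a parametrized curve. -/
def speed (g : Metric M) (γ : ℝ → M) (t : ℝ) : ℝ :=
  Real.sqrt (g.inner (γ t) (velocity γ t) (velocity γ t))

/-- The unit tangent vector `U^a`. -/
def unitTangent (g : Metric M) (γ : ℝ → M) (t : ℝ) : TangentSpace (𝓡 2) (γ t) :=
  (speed g γ t)⁻¹ • velocity γ t

/-- The endomorphism `v^c ↦ Γ_ab^c U^a v^b`, in the chart around `γ t`. -/
def christoffelAlong (g : Metric M) (γ : ℝ → M) (t : ℝ) : Plane →L[ℝ] Plane :=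
  christoffel g (γ t) (coframe (γ t) (γ t) (unitTangent g γ t))

/-- `∂ f = U^a ∇_a f` for a function along `γ`. -/
def dFun (g : Metric M) (γ : ℝ → M) (f : ℝ → ℝ) (t : ℝ) : ℝ :=
  (speed g γ t)⁻¹ * deriv f t

/-- `∂ α_b = U^a ∇_a α_b` for a covector field along `γ`, in components
`U(α_b) - Γ_ab^c U^a α_c`. -/
def dCovector (g : Metric M) (γ : ℝ → M) (α : ∀ t, Covector (γ t)) (t : ℝ) : Covector (γ t) :=
  ((speed g γ t)⁻¹ • deriv (fun s => covectorCoords (γ t) (γ s) (α s)) t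
    - covectorCoords (γ t) (γ t) (α t) ∘L christoffelAlong g γ t) ∘L coframe (γ t) (γ t)

/-- The components of `∂ B_bc = U^a ∇_a B_bc` at `γ t` in the chart around `γ t`:
`U(B_bc) - Γ_ab^d U^a B_dc - Γ_ac^d U^a B_bd`. -/
def dBilinCoords (g : Metric M) (γ : ℝ → M) (B : ∀ t, BilinForm (γ t)) (t : ℝ) :
    Plane →L[ℝ] Plane →L[ℝ] ℝ :=
  (speed g γ t)⁻¹ • deriv (fun s => bilinCoords (γ t) (γ s) (B s)) t
    - bilinCoords (γ t) (γ t) (B t) ∘L christoffelAlong g γ t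
    - ContinuousLinearMap.precomp ℝ (christoffelAlong g γ t) ∘L bilinCoords (γ t) (γ t) (B t)

lemma deriv_apply_self {B : ℝ → Plane →L[ℝ] Plane →L[ℝ] ℝ} (v : Plane)
    (h : ∀ s, B s v v = 0) (t : ℝ) : deriv B t v v = 0 := by
  by_cases hB : DifferentiableAt ℝ B t
  · have h1 : HasDerivAt (fun s => B s v) (deriv B t v) t :=
      (ContinuousLinearMap.apply ℝ (Plane →L[ℝ] ℝ) v).hasFDerivAt.comp_hasDerivAt t hB.hasDerivAt
    have h2 : HasDerivAt (fun s => B s v v) (deriv B t v v) t :=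
      (ContinuousLinearMap.apply ℝ ℝ v).hasFDerivAt.comp_hasDerivAt t h1
    have h3 : (fun s => B s v v) = fun _ => (0 : ℝ) := funext h
    rw [h3] at h2
    exact h2.unique (hasDerivAt_const t (0 : ℝ))
  · simp [deriv_zero_of_not_differentiableAt hB]

lemma dBilinCoords_self (g : Metric M) (γ : ℝ → M) (μ : ∀ t, TwoForm (γ t)) (t : ℝ) (v : Plane) :
    dBilinCoords g γ (fun s => (μ s).1) t v v = 0 := by
  have hd := deriv_apply_self (B := fun s => bilinCoords (γ t) (γ s) (μ s).1) v
    (fun s => (μ s).2 _) t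
  have hs : bilinCoords (γ t) (γ t) (μ t).1 (christoffelAlong g γ t v) v
      + bilinCoords (γ t) (γ t) (μ t).1 v (christoffelAlong g γ t v) = 0 :=
    TwoForm.skew (μ t) (frame (γ t) (γ t) (christoffelAlong g γ t v)) (frame (γ t) (γ t) v)
  have he : dBilinCoords g γ (fun s => (μ s).1) t v v
      = (speed g γ t)⁻¹ * deriv (fun s => bilinCoords (γ t) (γ s) (μ s).1) t v v
        - bilinCoords (γ t) (γ t) (μ t).1 (christoffelAlong g γ t v) v
        - bilinCoords (γ t) (γ t) (μ t).1 v (christoffelAlong g γ t v) := rfl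
  rw [he, hd]
  linarith

/-- `∂ μ_bc = U^a ∇_a μ_bc` for a 2-form along `γ`. -/
def dTwoForm (g : Metric M) (γ : ℝ → M) (μ : ∀ t, TwoForm (γ t)) (t : ℝ) : TwoForm (γ t) :=
  ⟨ContinuousLinearMap.precomp ℝ (coframe (γ t) (γ t)) ∘L
      dBilinCoords g γ (fun s => (μ s).1) t ∘L coframe (γ t) (γ t), by
    intro v
    exact dBilinCoords_self g γ μ t (coframe (γ t) (γ t) v)⟩

/-! ### Invariants of a curve in a chosen metric -/

/-- `U_a`. -/
def tangentForm (g : Metric M) (γ : ℝ → M) (t : ℝ) : Covector (γ t) := flat g (unitTangent g γ t)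

/-- The acceleration `A_a = ∂ U_a`. -/
def acceleration (g : Metric M) (γ : ℝ → M) (t : ℝ) : Covector (γ t) :=
  dCovector g γ (tangentForm g γ) t

/-- `A^a A_a`. -/
def accelerationSq (g : Metric M) (γ : ℝ → M) (t : ℝ) : ℝ :=
  cometric g (acceleration g γ t) (acceleration g γ t)

section Curve

variable (c : MobiusStructure M) (g : c.metrics) (γ : ℝ → M)

/-- `U^a P_ab`. -/
def rhoForm (t : ℝ) : Covector (γ t) := c.rho g (γ t) (unitTangent g.1 γ t)

/-- `U^a U^b P_ab`. -/
def rhoTangent (t : ℝ) : ℝ := rhoForm c g γ t (unitTangent g.1 γ t)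

/-- The normalised jerk `J_a = ∂ A_a + (A^b A_b + P_bc U^b U^c) U_a - P_ab U^b`. -/
def jerk (t : ℝ) : Covector (γ t) :=
  dCovector g.1 γ (acceleration g.1 γ) t
    + (accelerationSq g.1 γ t + rhoTangent c g γ t) • tangentForm g.1 γ t
    - rhoForm c g γ t

/-- The lift `(U_b, 2 U_[b A_c], κ, J_b + ½ (A^c A_c - κ²) U_b + κ A_b)` of the unit tangent. -/
def lift (κ : ℝ → ℝ) (t : ℝ) : TractorInScale (γ t) :=
  (tangentForm g.1 γ t,
   wedge (tangentForm g.1 γ t) (acceleration g.1 γ t),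
   κ t,
   jerk c g γ t
     + (1 / 2 * (accelerationSq g.1 γ t - κ t ^ 2)) • tangentForm g.1 γ t
     + κ t • acceleration g.1 γ t)

/-- `∂κ + ½ (A^a A_a + κ²) + U^a U^b P_ab`. -/
def loxodromeExpr (κ : ℝ → ℝ) (t : ℝ) : ℝ :=
  dFun g.1 γ κ t + 1 / 2 * (accelerationSq g.1 γ t + κ t ^ 2) + rhoTangent c g γ t

/-- The directional derivative `∂ = U^a ∇_a` of the adjoint tractor connection along `γ`, in the
metric `g`; the components are
`∂σ_b - U^a μ_ab - ν U_b`,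
`∂μ_bc - 2 U_[b ρ_c] + 2 U^a P_a[b σ_c]`,
`∂ν + U^a ρ_a + U^a P_a^b σ_b`,
`∂ρ_b - U^a P_a^c μ_bc - U^a P_ab ν`, where `- μ_bc = μ_cb` is used in the last one. -/
def dTractor (s : ∀ t, TractorInScale (γ t)) (t : ℝ) : TractorInScale (γ t) :=
  (dCovector g.1 γ (fun r => (s r).1) t
     - (s t).2.1.1 (unitTangent g.1 γ t) - (s t).2.2.1 • tangentForm g.1 γ t,
   dTwoForm g.1 γ (fun r => (s r).2.1) t
     - wedge (tangentForm g.1 γ t) (s t).2.2.2 + wedge (rhoForm c g γ t) (s t).1,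
   dFun g.1 γ (fun r => (s r).2.2.1) t
     + (s t).2.2.2 (unitTangent g.1 γ t) + cometric g.1 (rhoForm c g γ t) (s t).1,
   dCovector g.1 γ (fun r => (s r).2.2.2) t
     + (s t).2.1.1 (sharp g.1 (rhoForm c g γ t)) - (s t).2.2.1 • rhoForm c g γ t)

end Curve

/-! ### The canonical line subbundle along a curve -/

section Line

variable (c : MobiusStructure M) (γ : ℝ → M) (I : Set ℝ)

/-- For each metric `g` of the class, `κ g` satisfies `∂ J_b + A^c J_c U_b + 2 κ J_b = 0`
on `I`. -/
def DefinesKappa (κ : c.metrics → ℝ → ℝ) : Prop :=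
  ∀ (g : c.metrics), ∀ t ∈ I,
    dCovector g.1 γ (jerk c g γ) t
      + cometric g.1 (acceleration g.1 γ t) (jerk c g γ t) • tangentForm g.1 γ t
      + (2 * κ g t) • jerk c g γ t = 0

/-- Smoothness of a section along `γ` over `I`: in every metric of the class, the components
of the quadruple in local coordinates are smooth functions of the parameter. -/
def IsSmoothSection (s : ∀ t, c.metrics → TractorInScale (γ t)) : Prop :=
  ∀ (g : c.metrics), ∀ t₀ ∈ I,
    ContDiffAt ℝ ∞ (fun t => covectorCoords (γ t₀) (γ t) (s t g).1) t₀ ∧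
    ContDiffAt ℝ ∞ (fun t => bilinCoords (γ t₀) (γ t) (s t g).2.1.1) t₀ ∧
    ContDiffAt ℝ ∞ (fun t => (s t g).2.2.1) t₀ ∧
    ContDiffAt ℝ ∞ (fun t => covectorCoords (γ t₀) (γ t) (s t g).2.2.2) t₀

/-- The fibre over `γ t` of the line subbundle of `𝒜[w]` along `γ`: the adjoint tractors of
weight `w` that are multiples of the lift of `U_b` in every metric of the class. -/
def canonicalLine (κ : c.metrics → ℝ → ℝ) (w : ℤ) (t : ℝ) :
    Submodule ℝ (c.metrics → TractorInScale (γ t)) :=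
  AdjointTractor c w (γ t) ⊓
    Submodule.pi Set.univ (fun g => Submodule.span ℝ {lift c g γ (κ g) t})

/-- The line subbundle of `𝒜` along `γ` is preserved by `∂ : 𝒜 → 𝒜[-1]`: the operator `∂` takes
its smooth sections over `I` to sections of the corresponding line subbundle of `𝒜[-1]`. -/
def IsPreserved (κ : c.metrics → ℝ → ℝ) : Prop :=
  ∀ s : ∀ t, c.metrics → TractorInScale (γ t),
    IsSmoothSection c γ I s → (∀ t ∈ I, s t ∈ canonicalLine c γ κ 0 t) →
    ∀ t ∈ I, (fun g => dTractor c g γ (fun r => s r g) t) ∈ canonicalLine c γ κ (-1) t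

end Line

end Surface

end Mobius

end

set_option linter.unusedSectionVars false

noncomputable section

namespace Mobius

/-! ### Bilinear forms and Christoffel symbols on a normed space -/

section Calculus

open Filter Topology

variable {E : Type*} [NormedAddCommGroup E] [NormedSpace ℝ E]

/-! Write `U`, `A`, `J` for the covectors of the curve, `L` for the loxodrome expression and `s` for
the lift in one metric. Differentiating `U(U) = 1` and then `A(U) = 0` gives `A(U) = 0` and `J(U) =
0`; differentiating `J(U) = 0` shows that `∂J + ⟨A, J⟩ U` annihilates `U` as well. Covectors
annihilating `U` form a line in dimension two, so this covector is a multiple of `J`, and `κ` is the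
unique smooth coefficient (`kappa_spec`, `kappa_unique`).

Under `g' = Ω² g` everything follows from the change of `∂` on covectors
(`IsRescaling.dCovector_eq`) and the given change of `P`. They yield `A' = A - Υ + Υ(U) U`, `J' =
Ω⁻¹ J`, and, comparing the two equations that define `κ` and `κ'`, `κ' = Ω⁻¹ (κ + Υ(U))`. With these
laws the lift has weight `-1` (`lift_rescale`) and `L` has weight `-2` (`loxodromeExpr_rescale`), by
direct substitution.

The heart is the identity `dTractor_smul_lift`: `∂(a s) = (∂a - κ a) s + a L (0, 0, 1, A - κ U)`.
The last quadruple has zero first slot while the first slot of `s` is `U ≠ 0`, so they are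
independent and the line is preserved exactly when `L = 0`. For necessity the identity is applied to
a nowhere vanishing section of weight `0`; for sufficiency the weight `-1` of the image is read off
from the coefficient `∂a - κ a`, which is the same number in every metric. The weight of `L` makes
its vanishing independent of the metric.

The connection is defined pointwise in the chart centred at the current point, a chart that varies
along the curve. Smoothness and repeated differentiation therefore rest on chart independence
(`dCovector_chart_independent`). -/

lemma isInvertible_of_pos [FiniteDimensional ℝ E] (B : E →L[ℝ] E →L[ℝ] ℝ)
    (hB : ∀ v, v ≠ 0 → 0 < B v v) : B.IsInvertible := by
  have hinj : Function.Injective B := by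
    rw [injective_iff_map_eq_zero]
    intro v hv
    by_contra hne
    have := hB v hne
    simp [hv] at this
  have hdim : Module.finrank ℝ E = Module.finrank ℝ (E →L[ℝ] ℝ) := by
    rw [← (LinearMap.toContinuousLinearMap (𝕜 := ℝ) (E := E) (F' := ℝ)).finrank_eq]
    exact (Subspace.dual_finrank_eq (K := ℝ) (V := E)).symm
  let e : E ≃ₗ[ℝ] (E →L[ℝ] ℝ) :=
    LinearEquiv.ofBijective B.toLinearMap
      ⟨hinj, (LinearMap.injective_iff_surjective_of_finrank_eq_finrank hdim).1 hinj⟩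
  refine ⟨e.toContinuousLinearEquiv, ?_⟩
  ext v w
  rfl

/-- Christoffel symbols of the first kind of a field of bilinear forms on a normed space. -/
def christoffelForm (G : E → E →L[ℝ] E →L[ℝ] ℝ) (y u : E) : E →L[ℝ] E →L[ℝ] ℝ :=
  (1 / 2 : ℝ) • (fderiv ℝ G y u + (fderiv ℝ G y).flip u - ((fderiv ℝ G y).flip u).flip)

lemma christoffelForm_apply (G : E → E →L[ℝ] E →L[ℝ] ℝ) (y u v w : E) :
    christoffelForm G y u v w
      = 1 / 2 * (fderiv ℝ G y u v w + fderiv ℝ G y v u w - fderiv ℝ G y w u v) := by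
  simp [christoffelForm]

lemma fderiv_apply₂ {G : E → E →L[ℝ] E →L[ℝ] ℝ} {y : E} (hG : DifferentiableAt ℝ G y)
    (u v w : E) : fderiv ℝ (fun z => G z v w) y u = fderiv ℝ G y u v w := by
  have h := (hG.hasFDerivAt.clm_apply (hasFDerivAt_const v y)).clm_apply (hasFDerivAt_const w y)
  rw [h.fderiv]
  simp

lemma fderiv_symm {G : E → E →L[ℝ] E →L[ℝ] ℝ} {y : E} (hG : DifferentiableAt ℝ G y)
    (hs : ∀ z v w, G z v w = G z w v) (u v w : E) :
    fderiv ℝ G y u v w = fderiv ℝ G y u w v := by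
  rw [← fderiv_apply₂ hG, ← fderiv_apply₂ hG]
  simp_rw [hs _ v w]

/-- Metric compatibility in coordinates: the two derivative terms other than `D_u G(v, w)` are
exchanged with opposite signs when `v` and `w` are swapped. -/
lemma christoffelForm_add_swap {G : E → E →L[ℝ] E →L[ℝ] ℝ} {y : E}
    (hG : DifferentiableAt ℝ G y) (hs : ∀ z v w, G z v w = G z w v) (u v w : E) :
    christoffelForm G y u v w + christoffelForm G y u w v = fderiv ℝ G y u v w := by
  rw [christoffelForm_apply, christoffelForm_apply, fderiv_symm hG hs u w v]
  ring

/-- The transformation of the Christoffel symbols of the first kind under a change of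
coordinates. -/
lemma christoffelForm_pullback {F : Type*} [NormedAddCommGroup F] [NormedSpace ℝ F]
    {G : E → E →L[ℝ] E →L[ℝ] ℝ} {G' : F → F →L[ℝ] F →L[ℝ] ℝ} {Φ : F → E} {y : F}
    (hΦ : ContDiffAt ℝ 2 Φ y) (hG : DifferentiableAt ℝ G (Φ y)) (hG' : DifferentiableAt ℝ G' y)
    (hs : ∀ z v w, G z v w = G z w v)
    (hpull : ∀ᶠ z in 𝓝 y, ∀ v w, G' z v w = G (Φ z) (fderiv ℝ Φ z v) (fderiv ℝ Φ z w))
    (u v w : F) :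
    christoffelForm G' y u v w
      = christoffelForm G (Φ y) (fderiv ℝ Φ y u) (fderiv ℝ Φ y v) (fderiv ℝ Φ y w)
        + G (Φ y) (fderiv ℝ (fderiv ℝ Φ) y u v) (fderiv ℝ Φ y w) := by
  have hΦ1 : HasFDerivAt Φ (fderiv ℝ Φ y) y := (hΦ.differentiableAt (by norm_num)).hasFDerivAt
  have hΦ2 : HasFDerivAt (fderiv ℝ Φ) (fderiv ℝ (fderiv ℝ Φ) y) y :=
    ((hΦ.fderiv_right (m := 1) (by norm_num)).differentiableAt (by norm_num)).hasFDerivAt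
  have hsymm : ∀ a b, fderiv ℝ (fderiv ℝ Φ) y a b = fderiv ℝ (fderiv ℝ Φ) y b a :=
    fun a b => (hΦ.isSymmSndFDerivAt (by simp)).eq a b
  have key : ∀ a b c, fderiv ℝ G' y a b c
      = fderiv ℝ G (Φ y) (fderiv ℝ Φ y a) (fderiv ℝ Φ y b) (fderiv ℝ Φ y c)
        + G (Φ y) (fderiv ℝ (fderiv ℝ Φ) y a b) (fderiv ℝ Φ y c)
        + G (Φ y) (fderiv ℝ Φ y b) (fderiv ℝ (fderiv ℝ Φ) y a c) := by
    intro a b c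
    rw [← fderiv_apply₂ hG']
    have he : (fun z => G' z b c) =ᶠ[𝓝 y]
        fun z => G (Φ z) (fderiv ℝ Φ z b) (fderiv ℝ Φ z c) :=
      hpull.mono fun z hz => hz b c
    rw [he.fderiv_eq]
    have h1 := hG.hasFDerivAt.comp y hΦ1
    have h := (h1.clm_apply (hΦ2.clm_apply (hasFDerivAt_const b y))).clm_apply
      (hΦ2.clm_apply (hasFDerivAt_const c y))
    have h2 := congrArg (fun L => L a) h.fderiv
    simp only [Function.comp_apply] at h2
    refine h2.trans ?_
    simp
    ring
  -- Six terms contain second derivatives of `Φ`. By symmetry of `G` and of the second derivative,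
  -- the two with `D²Φ(u, v)` agree and the other four cancel in pairs.
  simp only [christoffelForm_apply, key, hsymm v u, hsymm w u, hsymm w v,
    hs _ (fderiv ℝ Φ y u) (fderiv ℝ (fderiv ℝ Φ) y v w)]
  rw [hs _ (fderiv ℝ Φ y v) (fderiv ℝ (fderiv ℝ Φ) y u w)]
  ring

/-- The transformation of the Christoffel symbols of the first kind under a conformal rescaling. -/
lemma christoffelForm_conformal {G G' : E → E →L[ℝ] E →L[ℝ] ℝ} {f : E → ℝ} {y : E}
    (hf : DifferentiableAt ℝ f y) (hG : DifferentiableAt ℝ G y)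
    (hG' : G' =ᶠ[𝓝 y] fun z => f z ^ 2 • G z) (u v w : E) :
    christoffelForm G' y u v w = f y ^ 2 * christoffelForm G y u v w
      + f y * (fderiv ℝ f y u * G y v w + fderiv ℝ f y v * G y u w
        - fderiv ℝ f y w * G y u v) := by
  have key : ∀ a b c, fderiv ℝ G' y a b c
      = f y ^ 2 * fderiv ℝ G y a b c + 2 * f y * fderiv ℝ f y a * G y b c := by
    intro a b c
    have h := ((hf.hasFDerivAt.pow 2).smul hG.hasFDerivAt)
    rw [hG'.fderiv_eq]
    have h2 := congrArg (fun L => L a b c) h.fderiv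
    refine h2.trans ?_
    simp
  simp only [christoffelForm_apply, key]
  ring

end Calculus

/-! ### Chart frames, transition maps and smooth components -/

section Charts

open Filter Topology

variable {M : Type*} [TopologicalSpace M] [ChartedSpace Plane M] [IsManifold (𝓡 2) ∞ M]

lemma frame_coframe {x₀ x : M} (hx : x ∈ (chartAt Plane x₀).source) (v : TangentSpace (𝓡 2) x) :
    frame x₀ x (coframe x₀ x v) = v :=
  (trivializationAt Plane (fun y : M => TangentSpace (𝓡 2) y) x₀).symmL_continuousLinearMapAt
    (R := ℝ) (b := x) hx v

lemma coframe_frame {x₀ x : M} (hx : x ∈ (chartAt Plane x₀).source) (v : Plane) :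
    coframe x₀ x (frame x₀ x v) = v :=
  (trivializationAt Plane (fun y : M => TangentSpace (𝓡 2) y) x₀).continuousLinearMapAt_symmL
    (R := ℝ) (b := x) hx v

lemma coframe_eq_mfderiv {x₀ x : M} (hx : x ∈ (chartAt Plane x₀).source) :
    coframe x₀ x = mfderiv (𝓡 2) 𝓘(ℝ, Plane) (extChartAt (𝓡 2) x₀) x :=
  TangentBundle.continuousLinearMapAt_trivializationAt hx

lemma frame_eq_mfderiv {x₀ x : M} (hx : x ∈ (chartAt Plane x₀).source) :
    frame x₀ x
      = mfderiv 𝓘(ℝ, Plane) (𝓡 2) (extChartAt (𝓡 2) x₀).symm (extChartAt (𝓡 2) x₀ x) := by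
  have h := TangentBundle.symmL_trivializationAt (I := 𝓡 2) hx
  rw [ModelWithCorners.Boundaryless.range_eq_univ, mfderivWithin_univ] at h
  exact h

lemma extChartAt_symm_eventually {x₀ x : M} (hx : x ∈ (chartAt Plane x₀).source) :
    ∀ᶠ y in 𝓝 (extChartAt (𝓡 2) x₀ x), y ∈ (extChartAt (𝓡 2) x₀).target :=
  (isOpen_extChartAt_target x₀).mem_nhds
    ((extChartAt (𝓡 2) x₀).map_source (by simpa using hx))

lemma symm_mem_chart_source {x₀ : M} {y : Plane} (hy : y ∈ (extChartAt (𝓡 2) x₀).target) :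
    (extChartAt (𝓡 2) x₀).symm y ∈ (chartAt Plane x₀).source := by
  have := (extChartAt (𝓡 2) x₀).map_target hy
  simpa using this

lemma extChartAt_left_inv {x₀ x : M} (hx : x ∈ (chartAt Plane x₀).source) :
    (extChartAt (𝓡 2) x₀).symm (extChartAt (𝓡 2) x₀ x) = x :=
  (extChartAt (𝓡 2) x₀).left_inv (by simpa using hx)

lemma contMDiffAt_symm {x₀ x : M} (hx : x ∈ (chartAt Plane x₀).source) :
    ContMDiffAt 𝓘(ℝ, Plane) (𝓡 2) ∞ (extChartAt (𝓡 2) x₀).symm (extChartAt (𝓡 2) x₀ x) :=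
  (contMDiffOn_extChartAt_symm x₀).contMDiffAt (extChartAt_symm_eventually hx)

/-- The transition map from the chart around `x` to the chart around `x₀`. -/
def transition (x₀ x : M) (y : Plane) : Plane :=
  extChartAt (𝓡 2) x₀ ((extChartAt (𝓡 2) x).symm y)

lemma transition_contDiffAt {x₀ x z : M} (hz₀ : z ∈ (chartAt Plane x₀).source)
    (hz : z ∈ (chartAt Plane x).source) :
    ContDiffAt ℝ ∞ (transition x₀ x) (extChartAt (𝓡 2) x z) := by
  rw [← contMDiffAt_iff_contDiffAt]
  refine ContMDiffAt.comp (I' := 𝓡 2) _ ?_ (contMDiffAt_symm hz)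
  rw [extChartAt_left_inv hz]
  exact contMDiffAt_extChartAt' hz₀

lemma fderiv_transition {x₀ x z : M} (hz₀ : z ∈ (chartAt Plane x₀).source)
    (hz : z ∈ (chartAt Plane x).source) (v : Plane) :
    fderiv ℝ (transition x₀ x) (extChartAt (𝓡 2) x z) v = coframe x₀ z (frame x z v) := by
  rw [coframe_eq_mfderiv hz₀, frame_eq_mfderiv hz, ← mfderiv_eq_fderiv]
  have h1 : MDifferentiableAt 𝓘(ℝ, Plane) (𝓡 2) (extChartAt (𝓡 2) x).symm
      (extChartAt (𝓡 2) x z) := (contMDiffAt_symm hz).mdifferentiableAt (by simp)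
  have h2 : MDifferentiableAt (𝓡 2) 𝓘(ℝ, Plane) (extChartAt (𝓡 2) x₀) z :=
    mdifferentiableAt_extChartAt hz₀
  have h3 := mfderiv_comp_of_eq (I' := 𝓡 2) (x := extChartAt (𝓡 2) x z) (y := z) h2 h1
    (extChartAt_left_inv hz)
  rw [extChartAt_left_inv hz] at h3
  exact congrArg (fun L => L v) h3

lemma covectorCoords_apply_coframe {x₀ x : M} (hx : x ∈ (chartAt Plane x₀).source)
    (α : Covector x) (v : TangentSpace (𝓡 2) x) :
    covectorCoords x₀ x α (coframe x₀ x v) = α v :=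
  congrArg α (frame_coframe hx v)

lemma bilinCoords_apply {x₀ x : M} (B : BilinForm x) (v w : Plane) :
    bilinCoords x₀ x B v w = B (frame x₀ x v) (frame x₀ x w) := rfl

lemma bilinCoords_apply_coframe {x₀ x : M} (hx : x ∈ (chartAt Plane x₀).source)
    (B : BilinForm x) (v w : TangentSpace (𝓡 2) x) :
    bilinCoords x₀ x B (coframe x₀ x v) (coframe x₀ x w) = B v w := by
  rw [bilinCoords_apply, frame_coframe hx, frame_coframe hx]

/-- Components of a field of bilinear forms in the chart around `x₀`. -/
def bilinField (B : ∀ x : M, BilinForm x) (x₀ : M) (y : Plane) : Plane →L[ℝ] Plane →L[ℝ] ℝ :=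
  bilinCoords x₀ ((extChartAt (𝓡 2) x₀).symm y) (B ((extChartAt (𝓡 2) x₀).symm y))

lemma bilinField_extChartAt (B : ∀ x : M, BilinForm x) {x₀ x : M}
    (hx : x ∈ (chartAt Plane x₀).source) :
    bilinField B x₀ (extChartAt (𝓡 2) x₀ x) = bilinCoords x₀ x (B x) := by
  rw [bilinField, extChartAt_left_inv hx]

/-- In the trivialization of the bundle of bilinear forms induced by the chart, the coordinates of
`B` are exactly its components in the chart frame. Applied to both the metric and the Rho-tensor. -/
lemma bilinField_contDiffAt {B : ∀ x : M, BilinForm x}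
    (hB : ContMDiff (𝓡 2) ((𝓡 2).prod 𝓘(ℝ, Plane →L[ℝ] Plane →L[ℝ] ℝ)) ∞
      (fun x : M => Bundle.TotalSpace.mk' (Plane →L[ℝ] Plane →L[ℝ] ℝ)
        (E := fun x : M => BilinForm x) x (B x))) {x₀ x : M}
    (hx : x ∈ (chartAt Plane x₀).source) :
    ContDiffAt ℝ ∞ (bilinField B x₀) (extChartAt (𝓡 2) x₀ x) := by
  rw [← contMDiffAt_iff_contDiffAt]
  have h1 : ContMDiffOn (𝓡 2) 𝓘(ℝ, Plane →L[ℝ] Plane →L[ℝ] ℝ) ∞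
      (fun z => bilinCoords x₀ z (B z)) (chartAt Plane x₀).source := by
    have hsub : (chartAt Plane x₀).source ⊆
        (trivializationAt (Plane →L[ℝ] Plane →L[ℝ] ℝ) (fun x : M => BilinForm x) x₀).baseSet :=
      fun z hz => ⟨hz, hz, Set.mem_univ z⟩
    have h := (Bundle.Trivialization.contMDiffOn_section_iff (IB := 𝓡 2) (n := ∞)
      (e := trivializationAt (Plane →L[ℝ] Plane →L[ℝ] ℝ) (fun x : M => BilinForm x) x₀)
      (s := fun x => B x) (chartAt Plane x₀).open_source hsub).1 hB.contMDiffOn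
    refine h.congr ?_
    intro z hz
    ext v w
    refine (Eq.trans (inCoordinates_apply_eq₂ (F₁ := Plane) (F₂ := Plane) (F₃ := ℝ)
      (E₁ := fun x : M => TangentSpace (𝓡 2) x) (E₂ := fun x : M => TangentSpace (𝓡 2) x)
      (E₃ := Bundle.Trivial M ℝ) (x₀ := x₀) (ϕ := B z) (v := v) (w := w)
      hz hz (Set.mem_univ z)) ?_).symm
    simp only [Bundle.Trivial.fiberBundle_trivializationAt',
      Bundle.Trivial.linearMapAt_trivialization]
    have hf : ∀ u : Plane, frame x₀ z u
        = (trivializationAt Plane (fun y : M => TangentSpace (𝓡 2) y) x₀).symm z u :=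
      fun u => Bundle.Trivialization.symmL_apply _ hz u
    rw [bilinCoords_apply, hf, hf]
    rfl
  have h2 := h1.contMDiffAt ((chartAt Plane x₀).open_source.mem_nhds hx)
  exact ContMDiffAt.comp_of_eq h2 (contMDiffAt_symm hx) (extChartAt_left_inv hx)

end Charts

/-! ### Independence of the connection from the chart -/

section ChartIndependence

open Filter Topology

variable {M : Type*} [TopologicalSpace M] [ChartedSpace Plane M] [IsManifold (𝓡 2) ∞ M]

lemma inner_isInvertible (g : Metric M) (x : M) : (g.inner x).IsInvertible :=
  isInvertible_of_pos (E := Plane) (g.inner x) (g.pos x)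

lemma metricCoords_symm (g : Metric M) (x₀ : M) (y v w : Plane) :
    metricCoords g x₀ y v w = metricCoords g x₀ y w v :=
  g.symm _ _ _

lemma metricCoords_isInvertible (g : Metric M) {x₀ : M} {y : Plane}
    (hy : y ∈ (extChartAt (𝓡 2) x₀).target) : (metricCoords g x₀ y).IsInvertible := by
  refine isInvertible_of_pos _ fun v hv => g.pos _ _ fun h => hv ?_
  have h' := congrArg (coframe x₀ ((extChartAt (𝓡 2) x₀).symm y)) h
  rw [map_zero] at h'
  exact (coframe_frame (symm_mem_chart_source hy) v).symm.trans h'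

lemma metricCoords_contDiffAt (g : Metric M) {x₀ x : M} (hx : x ∈ (chartAt Plane x₀).source) :
    ContDiffAt ℝ ∞ (metricCoords g x₀) (extChartAt (𝓡 2) x₀ x) :=
  bilinField_contDiffAt g.contMDiff hx

lemma metricCoords_differentiableAt (g : Metric M) {x₀ x : M}
    (hx : x ∈ (chartAt Plane x₀).source) :
    DifferentiableAt ℝ (metricCoords g x₀) (extChartAt (𝓡 2) x₀ x) :=
  (metricCoords_contDiffAt g hx).differentiableAt (by simp)

lemma metricCoords_extChartAt (g : Metric M) {x₀ x : M} (hx : x ∈ (chartAt Plane x₀).source)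
    (v w : TangentSpace (𝓡 2) x) :
    metricCoords g x₀ (extChartAt (𝓡 2) x₀ x) (coframe x₀ x v) (coframe x₀ x w)
      = g.inner x v w := by
  have h : metricCoords g x₀ (extChartAt (𝓡 2) x₀ x) = bilinCoords x₀ x (g.inner x) :=
    bilinField_extChartAt g.inner hx
  rw [h, bilinCoords_apply_coframe hx]

/-- The Christoffel symbols of the Levi-Civita connection at the point with coordinates `y` in the
chart around `x₀`. -/
def christoffelAt (g : Metric M) (x₀ : M) (y u : Plane) : Plane →L[ℝ] Plane :=
  (metricCoords g x₀ y).inverse ∘L christoffelForm (metricCoords g x₀) y u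

lemma metricCoords_christoffelAt (g : Metric M) {x₀ : M} {y : Plane}
    (hy : y ∈ (extChartAt (𝓡 2) x₀).target) (u v w : Plane) :
    metricCoords g x₀ y (christoffelAt g x₀ y u v) w
      = christoffelForm (metricCoords g x₀) y u v w :=
  congrArg (fun L => L w) ((metricCoords_isInvertible g hy).self_apply_inverse _)

lemma eq_of_metricCoords (g : Metric M) {x₀ : M} {y : Plane}
    (hy : y ∈ (extChartAt (𝓡 2) x₀).target) {a b : Plane}
    (h : ∀ w, metricCoords g x₀ y a w = metricCoords g x₀ y b w) : a = b :=
  (metricCoords_isInvertible g hy).injective (ContinuousLinearMap.ext h)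

/-- The transformation of the Christoffel symbols under a change of chart. -/
lemma christoffelAt_transition (g : Metric M) {x₀ x z : M}
    (hz₀ : z ∈ (chartAt Plane x₀).source) (hz : z ∈ (chartAt Plane x).source) (u v : Plane) :
    fderiv ℝ (transition x₀ x) (extChartAt (𝓡 2) x z)
        (christoffelAt g x (extChartAt (𝓡 2) x z) u v)
      = christoffelAt g x₀ (extChartAt (𝓡 2) x₀ z)
          (fderiv ℝ (transition x₀ x) (extChartAt (𝓡 2) x z) u)
          (fderiv ℝ (transition x₀ x) (extChartAt (𝓡 2) x z) v)
        + fderiv ℝ (fderiv ℝ (transition x₀ x)) (extChartAt (𝓡 2) x z) u v := by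
  set y := extChartAt (𝓡 2) x z with hy
  have hΦy : transition x₀ x y = extChartAt (𝓡 2) x₀ z := by
    rw [transition, hy, extChartAt_left_inv hz]
  have hyt : y ∈ (extChartAt (𝓡 2) x).target := (extChartAt_symm_eventually hz).self_of_nhds
  have hyt₀ : extChartAt (𝓡 2) x₀ z ∈ (extChartAt (𝓡 2) x₀).target :=
    (extChartAt_symm_eventually hz₀).self_of_nhds
  have hmetric : ∀ z', z' ∈ (chartAt Plane x₀).source → z' ∈ (chartAt Plane x).source →
      ∀ v w, metricCoords g x (extChartAt (𝓡 2) x z') v w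
        = metricCoords g x₀ (extChartAt (𝓡 2) x₀ z')
          (fderiv ℝ (transition x₀ x) (extChartAt (𝓡 2) x z') v)
          (fderiv ℝ (transition x₀ x) (extChartAt (𝓡 2) x z') w) := by
    intro z' h₀ h v w
    rw [fderiv_transition h₀ h, fderiv_transition h₀ h, metricCoords_extChartAt g h₀,
      ← metricCoords_extChartAt g h, coframe_frame h, coframe_frame h]
  have hpull : ∀ᶠ y' in 𝓝 y, ∀ v w, metricCoords g x y' v w
      = metricCoords g x₀ (transition x₀ x y') (fderiv ℝ (transition x₀ x) y' v)
        (fderiv ℝ (transition x₀ x) y' w) := by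
    have hcont : ContinuousAt (extChartAt (𝓡 2) x).symm y :=
      (contMDiffAt_symm hz).continuousAt
    have hsrc : ∀ᶠ y' in 𝓝 y,
        (extChartAt (𝓡 2) x).symm y' ∈ (chartAt Plane x₀).source := by
      refine hcont.eventually ?_
      rw [hy, extChartAt_left_inv hz]
      exact (chartAt Plane x₀).open_source.mem_nhds hz₀
    filter_upwards [hsrc, extChartAt_symm_eventually hz] with y' h1 h2 v w
    have h3 := hmetric _ h1 (symm_mem_chart_source h2) v w
    rwa [(extChartAt (𝓡 2) x).right_inv h2] at h3
  -- Nondegeneracy reduces the claim to pairings with all `w`; writing `w` as an image under the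
  -- derivative of the transition map lets the pullback formula apply.
  have hsurj : ∀ w : Plane, ∃ w', fderiv ℝ (transition x₀ x) y w' = w := fun w =>
    ⟨coframe x z (frame x₀ z w), by
      rw [fderiv_transition hz₀ hz, frame_coframe hz, coframe_frame hz₀]⟩
  refine eq_of_metricCoords g hyt₀ fun w => ?_
  obtain ⟨w', rfl⟩ := hsurj w
  rw [map_add, add_apply, metricCoords_christoffelAt g hyt₀,
    ← hmetric z hz₀ hz, metricCoords_christoffelAt g hyt,
    christoffelForm_pullback (contDiffAt_infty.1 (transition_contDiffAt hz₀ hz) 2) ?_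
      (metricCoords_differentiableAt g hz) (metricCoords_symm g x₀) hpull, hΦy]
  rw [← hy, hΦy]
  exact metricCoords_differentiableAt g hz₀

lemma hasDerivAt_extChartAt_comp {γ : ℝ → M} {t : ℝ} {x₀ : M}
    (hγ : MDifferentiableAt 𝓘(ℝ, ℝ) (𝓡 2) γ t) (hx : γ t ∈ (chartAt Plane x₀).source) :
    HasDerivAt (fun s => extChartAt (𝓡 2) x₀ (γ s)) (coframe x₀ (γ t) (velocity γ t)) t := by
  have h := (mdifferentiableAt_extChartAt (I := 𝓡 2) hx).hasMFDerivAt.comp t hγ.hasMFDerivAt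
  have h2 : HasFDerivAt (fun s => extChartAt (𝓡 2) x₀ (γ s))
      ((coframe x₀ (γ t) : TangentSpace (𝓡 2) (γ t) →L[ℝ] Plane) ∘L
        (mfderiv 𝓘(ℝ, ℝ) (𝓡 2) γ t : ℝ →L[ℝ] TangentSpace (𝓡 2) (γ t))) t := by
    rw [coframe_eq_mfderiv hx]
    exact h.hasFDerivAt
  exact h2.hasDerivAt

/-- The components in the chart around `x₀` of the derivative of a covector field along a curve,
computed in that chart. -/
def dCovectorCoords (g : Metric M) (γ : ℝ → M) (x₀ : M) (α : ∀ t, Covector (γ t)) (t : ℝ) :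
    Plane →L[ℝ] ℝ :=
  (speed g γ t)⁻¹ • deriv (fun s => covectorCoords x₀ (γ s) (α s)) t
    - covectorCoords x₀ (γ t) (α t) ∘L christoffelAt g x₀ (extChartAt (𝓡 2) x₀ (γ t))
      (coframe x₀ (γ t) (unitTangent g γ t))

lemma dCovector_eq (g : Metric M) (γ : ℝ → M) (α : ∀ t, Covector (γ t)) (t : ℝ) :
    dCovector g γ α t = dCovectorCoords g γ (γ t) α t ∘L coframe (γ t) (γ t) := rfl

lemma covectorCoords_transition {x₀ x z : M} (hz₀ : z ∈ (chartAt Plane x₀).source)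
    (hz : z ∈ (chartAt Plane x).source) (α : Covector z) :
    covectorCoords x z α = covectorCoords x₀ z α ∘L
      fderiv ℝ (transition x₀ x) (extChartAt (𝓡 2) x z) := by
  ext v
  rw [ContinuousLinearMap.comp_apply, fderiv_transition hz₀ hz, covectorCoords_apply_coframe hz₀]
  rfl

/-- The derivative of a covector field along a curve may be computed in any chart. -/
theorem dCovector_chart_independent (g : Metric M) {γ : ℝ → M} {t : ℝ} {x₀ : M}
    (hγ : MDifferentiableAt 𝓘(ℝ, ℝ) (𝓡 2) γ t) (hx : γ t ∈ (chartAt Plane x₀).source)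
    {α : ∀ t, Covector (γ t)}
    (hα : DifferentiableAt ℝ (fun s => covectorCoords x₀ (γ s) (α s)) t) :
    dCovector g γ α t = dCovectorCoords g γ x₀ α t ∘L coframe x₀ (γ t) := by
  have hxx : γ t ∈ (chartAt Plane (γ t)).source := mem_chart_source Plane (γ t)
  have hy := hasDerivAt_extChartAt_comp hγ hxx
  have hΦ : HasFDerivAt (fderiv ℝ (transition x₀ (γ t)))
      (fderiv ℝ (fderiv ℝ (transition x₀ (γ t))) (extChartAt (𝓡 2) (γ t) (γ t)))
      (extChartAt (𝓡 2) (γ t) (γ t)) :=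
    ((contDiffAt_infty.1 (transition_contDiffAt hx hxx) 2).fderiv_right (m := 1)
      (by norm_num)).differentiableAt (by norm_num) |>.hasFDerivAt
  have hev : (fun s => covectorCoords (γ t) (γ s) (α s)) =ᶠ[𝓝 t]
      fun s => covectorCoords x₀ (γ s) (α s) ∘L
        fderiv ℝ (transition x₀ (γ t)) (extChartAt (𝓡 2) (γ t) (γ s)) := by
    have h1 := hγ.continuousAt.eventually ((chartAt Plane x₀).open_source.mem_nhds hx)
    have h2 := hγ.continuousAt.eventually ((chartAt Plane (γ t)).open_source.mem_nhds hxx)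
    filter_upwards [h1, h2] with s hs1 hs2
    exact covectorCoords_transition hs1 hs2 (α s)
  -- The product rule produces `α` applied to the second derivative of the transition map, which
  -- cancels the inhomogeneous term in `christoffelAt_transition`.
  have hd := (hα.hasDerivAt.clm_comp (hΦ.comp_hasDerivAt t hy)).deriv
  have hd' := hev.deriv_eq.trans hd
  ext v
  rw [dCovector_eq, ContinuousLinearMap.comp_apply, ContinuousLinearMap.comp_apply]
  simp only [dCovectorCoords]
  rw [hd', covectorCoords_transition hx hxx (α t)]
  simp only [sub_apply, smul_apply, add_apply, ContinuousLinearMap.comp_apply,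
    Function.comp_apply]
  rw [christoffelAt_transition g hx hxx, fderiv_transition hx hxx, fderiv_transition hx hxx,
    frame_coframe hxx, frame_coframe hxx]
  simp only [unitTangent, map_smul, map_add, smul_apply, smul_eq_mul]
  ring

end ChartIndependence

/-! ### Raising indices, unit tangents and their rescaling -/

section MetricAlgebra

variable {M : Type*} [TopologicalSpace M] [ChartedSpace Plane M] [IsManifold (𝓡 2) ∞ M]

lemma inner_sharp (g : Metric M) {x : M} (α : Covector x) : g.inner x (sharp g α) = α :=
  (inner_isInvertible g x).self_apply_inverse α

lemma sharp_flat (g : Metric M) {x : M} (v : TangentSpace (𝓡 2) x) : sharp g (flat g v) = v :=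
  (inner_isInvertible g x).inverse_apply_self v

lemma cometric_eq_inner (g : Metric M) {x : M} (α β : Covector x) :
    cometric g α β = g.inner x (sharp g β) (sharp g α) := by
  rw [inner_sharp]; rfl

lemma cometric_comm (g : Metric M) {x : M} (α β : Covector x) :
    cometric g α β = cometric g β α := by
  rw [cometric_eq_inner, cometric_eq_inner, g.symm]

lemma cometric_sub (g : Metric M) {x : M} (α β β' : Covector x) :
    cometric g α (β - β') = cometric g α β - cometric g α β' := rfl

lemma add_cometric (g : Metric M) {x : M} (α α' β : Covector x) :
    cometric g (α + α') β = cometric g α β + cometric g α' β := by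
  rw [cometric_comm, cometric_add, cometric_comm g β, cometric_comm g β]

lemma sub_cometric (g : Metric M) {x : M} (α α' β : Covector x) :
    cometric g (α - α') β = cometric g α β - cometric g α' β := by
  rw [cometric_comm, cometric_sub, cometric_comm g β, cometric_comm g β]

lemma smul_cometric (g : Metric M) {x : M} (r : ℝ) (α β : Covector x) :
    cometric g (r • α) β = r * cometric g α β := by
  rw [cometric_comm, cometric_smul, cometric_comm g β]

lemma cometric_pos (g : Metric M) {x : M} {α : Covector x} (hα : α ≠ 0) :
    0 < cometric g α α := by
  rw [cometric_eq_inner]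
  refine g.pos x _ fun h => hα ?_
  rw [← inner_sharp g α, h, map_zero]

lemma IsRescaling.sharp_eq {g g' : Metric M} {Ω : M → ℝ} (h : IsRescaling g g' Ω) {x : M}
    (α : Covector x) : sharp g' α = (Ω x ^ 2)⁻¹ • sharp g α := by
  have hΩ := (h.pos x).ne'
  apply (inner_isInvertible g' x).injective
  rw [inner_sharp]
  ext w
  rw [h.eq, map_smul, smul_apply, inner_sharp, smul_eq_mul]
  field_simp

lemma IsRescaling.cometric_eq {g g' : Metric M} {Ω : M → ℝ} (h : IsRescaling g g' Ω) {x : M}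
    (α β : Covector x) : cometric g' α β = (Ω x ^ 2)⁻¹ * cometric g α β := by
  simp only [cometric, h.sharp_eq, map_smul, smul_eq_mul]

section UnitTangent

variable (g : Metric M) {γ : ℝ → M} {t : ℝ}

lemma speed_sq (γ : ℝ → M) (t : ℝ) :
    speed g γ t ^ 2 = g.inner (γ t) (velocity γ t) (velocity γ t) := by
  refine Real.sq_sqrt ?_
  by_cases h : velocity γ t = 0
  · simp [h]
  · exact (g.pos _ _ h).le

lemma speed_pos (hv : velocity γ t ≠ 0) : 0 < speed g γ t :=
  Real.sqrt_pos.2 (g.pos _ _ hv)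

lemma tangentForm_unitTangent (hv : velocity γ t ≠ 0) :
    tangentForm g γ t (unitTangent g γ t) = 1 := by
  have h := (speed_pos g hv).ne'
  have h2 := speed_sq g γ t
  simp only [tangentForm, flat, unitTangent, map_smul, smul_apply, smul_eq_mul, ← h2]
  field_simp

lemma sharp_tangentForm (γ : ℝ → M) (t : ℝ) : sharp g (tangentForm g γ t) = unitTangent g γ t :=
  sharp_flat g _

lemma tangentForm_cometric (α : Covector (γ t)) :
    cometric g (tangentForm g γ t) α = α (unitTangent g γ t) := by
  rw [cometric, sharp_tangentForm]

lemma cometric_tangentForm (α : Covector (γ t)) :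
    cometric g α (tangentForm g γ t) = α (unitTangent g γ t) := by
  rw [cometric_comm, tangentForm_cometric]

variable {g} {g' : Metric M} {Ω : M → ℝ}

lemma IsRescaling.speed_eq (h : IsRescaling g g' Ω) (γ : ℝ → M) (t : ℝ) :
    speed g' γ t = Ω (γ t) * speed g γ t := by
  rw [speed, h.eq, Real.sqrt_mul (by positivity), Real.sqrt_sq (h.pos _).le, speed]

lemma IsRescaling.unitTangent_eq (h : IsRescaling g g' Ω) (γ : ℝ → M) (t : ℝ) :
    unitTangent g' γ t = (Ω (γ t))⁻¹ • unitTangent g γ t := by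
  rw [unitTangent, h.speed_eq, mul_inv, mul_smul, unitTangent]

lemma IsRescaling.tangentForm_eq (h : IsRescaling g g' Ω) (γ : ℝ → M) (t : ℝ) :
    tangentForm g' γ t = Ω (γ t) • tangentForm g γ t := by
  have hΩ := (h.pos (γ t)).ne'
  ext w
  rw [tangentForm, flat, h.eq, h.unitTangent_eq, map_smul, smul_apply, smul_apply, tangentForm,
    flat, smul_eq_mul, smul_eq_mul]
  field_simp

lemma IsRescaling.dFun_eq (h : IsRescaling g g' Ω) (γ : ℝ → M) (f : ℝ → ℝ) (t : ℝ) :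
    dFun g' γ f t = (Ω (γ t))⁻¹ * dFun g γ f t := by
  rw [dFun, dFun, h.speed_eq, mul_inv, mul_assoc]

end UnitTangent

end MetricAlgebra

/-! ### The conformal factor and the change of the connection -/

section Upsilon

open Filter Topology

variable {M : Type*} [TopologicalSpace M] [ChartedSpace Plane M] [IsManifold (𝓡 2) ∞ M]
variable {g g' : Metric M} {Ω : M → ℝ}

/-- A function on the surface in the coordinates of the chart around `x₀`. -/
def funCoords (Ω : M → ℝ) (x₀ : M) (y : Plane) : ℝ := Ω ((extChartAt (𝓡 2) x₀).symm y)

lemma IsRescaling.funCoords_contDiffAt (h : IsRescaling g g' Ω) {x₀ x : M}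
    (hx : x ∈ (chartAt Plane x₀).source) :
    ContDiffAt ℝ ∞ (funCoords Ω x₀) (extChartAt (𝓡 2) x₀ x) := by
  rw [← contMDiffAt_iff_contDiffAt]
  exact ContMDiffAt.comp (I' := 𝓡 2) _ h.smooth.contMDiffAt (contMDiffAt_symm hx)

lemma IsRescaling.fderiv_funCoords (h : IsRescaling g g' Ω) {x₀ x : M}
    (hx : x ∈ (chartAt Plane x₀).source) (v : Plane) :
    fderiv ℝ (funCoords Ω x₀) (extChartAt (𝓡 2) x₀ x) v
      = Ω x * upsilon Ω x (frame x₀ x v) := by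
  have hΩ := (h.pos x).ne'
  have h1 : MDifferentiableAt 𝓘(ℝ, Plane) (𝓡 2) (extChartAt (𝓡 2) x₀).symm
      (extChartAt (𝓡 2) x₀ x) := (contMDiffAt_symm hx).mdifferentiableAt (by simp)
  have h2 : MDifferentiableAt (𝓡 2) 𝓘(ℝ, ℝ) Ω x := h.smooth.mdifferentiableAt (by simp)
  have h3 := mfderiv_comp_of_eq (I' := 𝓡 2) (x := extChartAt (𝓡 2) x₀ x) (y := x) h2 h1
    (extChartAt_left_inv hx)
  rw [extChartAt_left_inv hx, ← frame_eq_mfderiv hx] at h3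
  rw [← mfderiv_eq_fderiv]
  refine (congrArg (fun L => L v) h3).trans ?_
  have h4 : upsilon Ω x (frame x₀ x v)
      = (Ω x)⁻¹ * mvfderiv (𝓡 2) Ω x (frame x₀ x v) := rfl
  rw [h4, mul_inv_cancel_left₀ hΩ]
  rfl

/-- Components of `Υ = Ω⁻¹ dΩ` in the chart around `x₀`. -/
def upsilonCoords (Ω : M → ℝ) (x₀ : M) (y : Plane) : Plane →L[ℝ] ℝ :=
  covectorCoords x₀ ((extChartAt (𝓡 2) x₀).symm y) (upsilon Ω ((extChartAt (𝓡 2) x₀).symm y))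

lemma upsilonCoords_extChartAt (Ω : M → ℝ) {x₀ x : M} (hx : x ∈ (chartAt Plane x₀).source) :
    upsilonCoords Ω x₀ (extChartAt (𝓡 2) x₀ x) = covectorCoords x₀ x (upsilon Ω x) := by
  rw [upsilonCoords, extChartAt_left_inv hx]

lemma IsRescaling.upsilonCoords_contDiffAt (h : IsRescaling g g' Ω) {x₀ x : M}
    (hx : x ∈ (chartAt Plane x₀).source) :
    ContDiffAt ℝ ∞ (upsilonCoords Ω x₀) (extChartAt (𝓡 2) x₀ x) := by
  have h1 := h.funCoords_contDiffAt hx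
  have h2 : ContDiffAt ℝ ∞ (fun y => (funCoords Ω x₀ y)⁻¹ • fderiv ℝ (funCoords Ω x₀) y)
      (extChartAt (𝓡 2) x₀ x) :=
    (h1.inv (h.pos _).ne').smul (h1.fderiv_right (m := ∞) (by simp))
  refine h2.congr_of_eventuallyEq ?_
  filter_upwards [extChartAt_symm_eventually hx] with y hy
  ext v
  have h3 := h.fderiv_funCoords (symm_mem_chart_source hy) v
  rw [(extChartAt (𝓡 2) x₀).right_inv hy] at h3
  rw [smul_apply, h3, smul_eq_mul, funCoords, inv_mul_cancel_left₀ (h.pos _).ne']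
  rfl

/-- The conformal change of the Christoffel symbols. -/
lemma IsRescaling.christoffelAt_eq (h : IsRescaling g g' Ω) {x₀ x : M}
    (hx : x ∈ (chartAt Plane x₀).source) (u v : TangentSpace (𝓡 2) x) :
    christoffelAt g' x₀ (extChartAt (𝓡 2) x₀ x) (coframe x₀ x u) (coframe x₀ x v)
      = christoffelAt g x₀ (extChartAt (𝓡 2) x₀ x) (coframe x₀ x u) (coframe x₀ x v)
        + coframe x₀ x (upsilon Ω x u • v + upsilon Ω x v • u
          - g.inner x u v • sharp g (upsilon Ω x)) := by
  have hΩ := (h.pos x).ne'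
  have hyt : extChartAt (𝓡 2) x₀ x ∈ (extChartAt (𝓡 2) x₀).target :=
    (extChartAt_symm_eventually hx).self_of_nhds
  have hG : metricCoords g' x₀ = fun y => funCoords Ω x₀ y ^ 2 • metricCoords g x₀ y := by
    ext y a b
    exact h.eq _ _ _
  refine eq_of_metricCoords g' hyt fun w => ?_
  obtain ⟨w, rfl⟩ : ∃ w', coframe x₀ x w' = w := ⟨_, coframe_frame hx w⟩
  rw [metricCoords_christoffelAt g' hyt, map_add, add_apply, metricCoords_extChartAt g' hx, h.eq,
    christoffelForm_conformal ((h.funCoords_contDiffAt hx).differentiableAt (by simp))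
      (metricCoords_differentiableAt g hx) (Eq.eventuallyEq hG)]
  have hf : funCoords Ω x₀ (extChartAt (𝓡 2) x₀ x) = Ω x := by
    rw [funCoords, extChartAt_left_inv hx]
  rw [h.fderiv_funCoords hx, h.fderiv_funCoords hx, h.fderiv_funCoords hx, frame_coframe hx,
    frame_coframe hx, frame_coframe hx, metricCoords_extChartAt g hx,
    metricCoords_extChartAt g hx, metricCoords_extChartAt g hx, hG, hf]
  simp only [smul_apply, hf, metricCoords_christoffelAt g hyt, map_add, map_sub, map_smul,
    add_apply, sub_apply, inner_sharp, smul_eq_mul]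
  ring

/-- The conformal change of the derivative of a covector field along a curve. -/
theorem IsRescaling.dCovector_eq (h : IsRescaling g g' Ω) (γ : ℝ → M)
    (α : ∀ t, Covector (γ t)) (t : ℝ) :
    dCovector g' γ α t = (Ω (γ t))⁻¹ • (dCovector g γ α t
      - upsilon Ω (γ t) (unitTangent g γ t) • α t
      - α t (unitTangent g γ t) • upsilon Ω (γ t)
      + cometric g (upsilon Ω (γ t)) (α t) • tangentForm g γ t) := by
  have hx : γ t ∈ (chartAt Plane (γ t)).source := mem_chart_source Plane (γ t)
  ext v
  simp only [Mobius.dCovector_eq, dCovectorCoords, ContinuousLinearMap.comp_apply, sub_apply,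
    smul_apply, add_apply, h.unitTangent_eq, map_smul]
  -- `christoffelAt` takes its direction as a plain argument, so homogeneity in it needs a proof; it
  -- moves the factor `Ω⁻¹` out of the new unit tangent.
  have hlin : ∀ (r : ℝ) (u w : Plane),
      christoffelAt g' (γ t) (extChartAt (𝓡 2) (γ t) (γ t)) (r • u) w
        = r • christoffelAt g' (γ t) (extChartAt (𝓡 2) (γ t) (γ t)) u w := by
    intro r u w
    refine eq_of_metricCoords g' (extChartAt_symm_eventually hx).self_of_nhds fun z => ?_
    simp only [metricCoords_christoffelAt g' (extChartAt_symm_eventually hx).self_of_nhds,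
      map_smul, smul_apply, smul_eq_mul, christoffelForm_apply]
    ring
  rw [hlin, h.christoffelAt_eq hx, map_smul, map_add, covectorCoords_apply_coframe hx,
    h.speed_eq]
  simp only [map_add, map_sub, map_smul, smul_eq_mul, mul_inv]
  have h1 : tangentForm g γ t v = g.inner (γ t) (unitTangent g γ t) v := rfl
  have h2 : cometric g (upsilon Ω (γ t)) (α t) = α t (sharp g (upsilon Ω (γ t))) := rfl
  rw [h1, h2]
  ring

/-- The derivative of the restriction of `Υ` to a curve is a directional derivative. -/
theorem IsRescaling.dCovector_upsilon (h : IsRescaling g g' Ω) (g₀ : Metric M) {γ : ℝ → M}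
    {t : ℝ} (hγ : MDifferentiableAt 𝓘(ℝ, ℝ) (𝓡 2) γ t) (v : TangentSpace (𝓡 2) (γ t)) :
    dCovector g₀ γ (fun s => upsilon Ω (γ s)) t v
      = nablaForm g₀ (upsilon Ω) (γ t) (unitTangent g₀ γ t) v := by
  have hx : γ t ∈ (chartAt Plane (γ t)).source := mem_chart_source Plane (γ t)
  have h1 := (((h.upsilonCoords_contDiffAt hx).differentiableAt (by simp)).hasFDerivAt
    |>.comp_hasDerivAt t (hasDerivAt_extChartAt_comp hγ hx)).deriv
  have h2 : (fun s => covectorCoords (γ t) (γ s) (upsilon Ω (γ s))) =ᶠ[𝓝 t]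
      upsilonCoords Ω (γ t) ∘ fun s => extChartAt (𝓡 2) (γ t) (γ s) := by
    filter_upwards [hγ.continuousAt.eventually ((chartAt Plane (γ t)).open_source.mem_nhds hx)]
      with s hs
    exact (upsilonCoords_extChartAt Ω hs).symm
  have h3 := h2.deriv_eq.trans h1
  rw [Mobius.dCovector_eq, ContinuousLinearMap.comp_apply, dCovectorCoords, h3]
  have h4 : coframe (γ t) (γ t) (unitTangent g₀ γ t)
      = (speed g₀ γ t)⁻¹ • coframe (γ t) (γ t) (velocity γ t) := map_smul _ _ _
  have h5 : nablaForm g₀ (upsilon Ω) (γ t) (unitTangent g₀ γ t) v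
      = fderiv ℝ (upsilonCoords Ω (γ t)) (extChartAt (𝓡 2) (γ t) (γ t))
          (coframe (γ t) (γ t) (unitTangent g₀ γ t)) (coframe (γ t) (γ t) v)
        - covectorCoords (γ t) (γ t) (upsilon Ω (γ t)) (christoffelAt g₀ (γ t)
            (extChartAt (𝓡 2) (γ t) (γ t)) (coframe (γ t) (γ t) (unitTangent g₀ γ t))
            (coframe (γ t) (γ t) v)) := rfl
  rw [h5, h4]
  simp only [sub_apply, smul_apply, map_smul, ContinuousLinearMap.comp_apply]

end Upsilon

/-! ### Smooth fields along a regular curve -/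

section Smoothness

open Filter Topology

variable {M : Type*} [TopologicalSpace M] [ChartedSpace Plane M] [IsManifold (𝓡 2) ∞ M]

/-- A smooth curve with nowhere vanishing velocity on an open set of parameters. -/
structure IsRegularOn (γ : ℝ → M) (I : Set ℝ) : Prop where
  isOpen : IsOpen I
  smooth : ContMDiffOn 𝓘(ℝ, ℝ) (𝓡 2) ∞ γ I
  velocity_ne_zero : ∀ t ∈ I, velocity γ t ≠ 0

/-- Smoothness at `t` of a covector field along a curve. -/
def CovectorSmoothAt (γ : ℝ → M) (α : ∀ t, Covector (γ t)) (t : ℝ) : Prop :=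
  ContDiffAt ℝ ∞ (fun s => covectorCoords (γ t) (γ s) (α s)) t

/-- Smoothness at `t` of a vector field along a curve. -/
def VectorSmoothAt (γ : ℝ → M) (v : ∀ t, TangentSpace (𝓡 2) (γ t)) (t : ℝ) : Prop :=
  ContDiffAt ℝ ∞ (fun s => coframe (γ t) (γ s) (v s)) t

variable {γ : ℝ → M} {I : Set ℝ} {t : ℝ}

namespace IsRegularOn

lemma mem_nhds (hγ : IsRegularOn γ I) (ht : t ∈ I) : I ∈ 𝓝 t := hγ.isOpen.mem_nhds ht

lemma contMDiffAt (hγ : IsRegularOn γ I) (ht : t ∈ I) : ContMDiffAt 𝓘(ℝ, ℝ) (𝓡 2) ∞ γ t :=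
  hγ.smooth.contMDiffAt (hγ.mem_nhds ht)

lemma mdifferentiableAt (hγ : IsRegularOn γ I) (ht : t ∈ I) :
    MDifferentiableAt 𝓘(ℝ, ℝ) (𝓡 2) γ t :=
  (hγ.contMDiffAt ht).mdifferentiableAt (by simp)

lemma eventually_mem_source (hγ : IsRegularOn γ I) (ht : t ∈ I) :
    ∀ᶠ s in 𝓝 t, γ s ∈ (chartAt Plane (γ t)).source :=
  (hγ.contMDiffAt ht).continuousAt.eventually
    ((chartAt Plane (γ t)).open_source.mem_nhds (mem_chart_source Plane (γ t)))

lemma coords_contDiffAt (hγ : IsRegularOn γ I) (ht : t ∈ I) :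
    ContDiffAt ℝ ∞ (fun s => extChartAt (𝓡 2) (γ t) (γ s)) t := by
  rw [← contMDiffAt_iff_contDiffAt]
  exact ContMDiffAt.comp (I' := 𝓡 2) _ contMDiffAt_extChartAt (hγ.contMDiffAt ht)

lemma velocity_smoothAt (hγ : IsRegularOn γ I) (ht : t ∈ I) :
    VectorSmoothAt γ (velocity γ) t := by
  have h : ContDiffAt ℝ ∞ (deriv fun s => extChartAt (𝓡 2) (γ t) (γ s)) t := by
    have h1 := (hγ.coords_contDiffAt ht).fderiv_right (m := ∞) (by simp)
    exact h1.clm_apply contDiffAt_const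
  refine h.congr_of_eventuallyEq ?_
  filter_upwards [hγ.mem_nhds ht, hγ.eventually_mem_source ht] with s hs hs'
  exact (hasDerivAt_extChartAt_comp (hγ.mdifferentiableAt hs) hs').deriv.symm

lemma bilin_smoothAt (hγ : IsRegularOn γ I) (ht : t ∈ I) {B : ∀ x : M, BilinForm x}
    (hB : ContMDiff (𝓡 2) ((𝓡 2).prod 𝓘(ℝ, Plane →L[ℝ] Plane →L[ℝ] ℝ)) ∞
      (fun x : M => Bundle.TotalSpace.mk' (Plane →L[ℝ] Plane →L[ℝ] ℝ)
        (E := fun x : M => BilinForm x) x (B x)))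
    {v : ∀ t, TangentSpace (𝓡 2) (γ t)} (hv : VectorSmoothAt γ v t) :
    CovectorSmoothAt γ (fun s => B (γ s) (v s)) t := by
  have h : ContDiffAt ℝ ∞ (fun s => bilinField B (γ t) (extChartAt (𝓡 2) (γ t) (γ s))
      (coframe (γ t) (γ s) (v s))) t :=
    (ContDiffAt.comp (g := bilinField B (γ t)) t
      (bilinField_contDiffAt hB (mem_chart_source Plane (γ t)))
      (hγ.coords_contDiffAt ht)).clm_apply hv
  refine h.congr_of_eventuallyEq ?_
  filter_upwards [hγ.eventually_mem_source ht] with s hs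
  rw [bilinField_extChartAt B hs]
  ext w
  rw [bilinCoords_apply, frame_coframe hs]
  rfl

lemma apply_smoothAt (hγ : IsRegularOn γ I) (ht : t ∈ I) {α : ∀ t, Covector (γ t)}
    (hα : CovectorSmoothAt γ α t) {v : ∀ t, TangentSpace (𝓡 2) (γ t)}
    (hv : VectorSmoothAt γ v t) : ContDiffAt ℝ ∞ (fun s => α s (v s)) t := by
  refine (hα.clm_apply hv).congr_of_eventuallyEq ?_
  filter_upwards [hγ.eventually_mem_source ht] with s hs
  exact (covectorCoords_apply_coframe hs _ _).symm

lemma sharp_smoothAt (hγ : IsRegularOn γ I) (ht : t ∈ I) (g : Metric M)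
    {α : ∀ t, Covector (γ t)} (hα : CovectorSmoothAt γ α t) :
    VectorSmoothAt γ (fun s => sharp g (α s)) t := by
  have hx := mem_chart_source Plane (γ t)
  have h1 : ContDiffAt ℝ ∞ (fun s => metricCoords g (γ t) (extChartAt (𝓡 2) (γ t) (γ s))) t :=
    ContDiffAt.comp (g := metricCoords g (γ t)) t (metricCoords_contDiffAt g hx)
      (hγ.coords_contDiffAt ht)
  have h2 : ContDiffAt ℝ ∞
      (fun s => (metricCoords g (γ t) (extChartAt (𝓡 2) (γ t) (γ s))).inverse) t :=
    ContDiffAt.comp (g := ContinuousLinearMap.inverse) t (metricCoords_isInvertible g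
      (extChartAt_symm_eventually hx).self_of_nhds).contDiffAt_map_inverse h1
  refine (h2.clm_apply hα).congr_of_eventuallyEq ?_
  filter_upwards [hγ.eventually_mem_source ht] with s hs
  have hinv := metricCoords_isInvertible g (extChartAt_symm_eventually hs).self_of_nhds
  apply hinv.injective
  rw [hinv.self_apply_inverse]
  ext w
  obtain ⟨w, rfl⟩ : ∃ w', coframe (γ t) (γ s) w' = w := ⟨_, coframe_frame hs w⟩
  rw [metricCoords_extChartAt g hs, inner_sharp, covectorCoords_apply_coframe hs]

lemma cometric_smoothAt (hγ : IsRegularOn γ I) (ht : t ∈ I) (g : Metric M)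
    {α β : ∀ t, Covector (γ t)} (hα : CovectorSmoothAt γ α t) (hβ : CovectorSmoothAt γ β t) :
    ContDiffAt ℝ ∞ (fun s => cometric g (α s) (β s)) t :=
  hγ.apply_smoothAt ht hβ (hγ.sharp_smoothAt ht g hα)

lemma speed_smoothAt (hγ : IsRegularOn γ I) (ht : t ∈ I) (g : Metric M) :
    ContDiffAt ℝ ∞ (speed g γ) t := by
  have hv := hγ.velocity_smoothAt ht
  exact (hγ.apply_smoothAt ht (hγ.bilin_smoothAt ht g.contMDiff hv) hv).sqrt
    (g.pos _ _ (hγ.velocity_ne_zero t ht)).ne'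

lemma speed_inv_smoothAt (hγ : IsRegularOn γ I) (ht : t ∈ I) (g : Metric M) :
    ContDiffAt ℝ ∞ (fun s => (speed g γ s)⁻¹) t :=
  (hγ.speed_smoothAt ht g).inv (speed_pos g (hγ.velocity_ne_zero t ht)).ne'

lemma unitTangent_smoothAt (hγ : IsRegularOn γ I) (ht : t ∈ I) (g : Metric M) :
    VectorSmoothAt γ (unitTangent g γ) t := by
  have h := (hγ.speed_inv_smoothAt ht g).smul (hγ.velocity_smoothAt ht)
  refine h.congr_of_eventuallyEq (Eventually.of_forall fun s => ?_)
  exact map_smul _ _ _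

lemma tangentForm_smoothAt (hγ : IsRegularOn γ I) (ht : t ∈ I) (g : Metric M) :
    CovectorSmoothAt γ (tangentForm g γ) t :=
  hγ.bilin_smoothAt ht g.contMDiff (hγ.unitTangent_smoothAt ht g)

/-- Near `t` the derivative can be computed in the single chart around `γ t`, where its components
are smooth expressions in the metric, its first derivatives, the velocity and `α`. -/
lemma dCovector_smoothAt (hγ : IsRegularOn γ I) (ht : t ∈ I) (g : Metric M)
    {α : ∀ t, Covector (γ t)} (hα : CovectorSmoothAt γ α t) :
    CovectorSmoothAt γ (dCovector g γ α) t := by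
  have hx := mem_chart_source Plane (γ t)
  have h1 : ContDiffAt ℝ ∞ (fun s => metricCoords g (γ t) (extChartAt (𝓡 2) (γ t) (γ s))) t :=
    ContDiffAt.comp (g := metricCoords g (γ t)) t (metricCoords_contDiffAt g hx)
      (hγ.coords_contDiffAt ht)
  have h2 : ContDiffAt ℝ ∞
      (fun s => (metricCoords g (γ t) (extChartAt (𝓡 2) (γ t) (γ s))).inverse) t :=
    ContDiffAt.comp (g := ContinuousLinearMap.inverse) t (metricCoords_isInvertible g
      (extChartAt_symm_eventually hx).self_of_nhds).contDiffAt_map_inverse h1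
  have h3 : ContDiffAt ℝ ∞
      (fun s => fderiv ℝ (metricCoords g (γ t)) (extChartAt (𝓡 2) (γ t) (γ s))) t :=
    ContDiffAt.comp (g := fderiv ℝ (metricCoords g (γ t))) t
      ((metricCoords_contDiffAt g hx).fderiv_right (m := ∞) (by simp)) (hγ.coords_contDiffAt ht)
  have hU := hγ.unitTangent_smoothAt ht g
  have hflip : ContDiffAt ℝ ∞ (fun s => (fderiv ℝ (metricCoords g (γ t))
      (extChartAt (𝓡 2) (γ t) (γ s))).flip (coframe (γ t) (γ s) (unitTangent g γ s))) t :=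
    (((ContinuousLinearMap.flipₗᵢ ℝ Plane Plane
      (Plane →L[ℝ] ℝ)).contDiff.contDiffAt).comp t h3).clm_apply hU
  have h4 : ContDiffAt ℝ ∞ (fun s => christoffelForm (metricCoords g (γ t))
      (extChartAt (𝓡 2) (γ t) (γ s)) (coframe (γ t) (γ s) (unitTangent g γ s))) t :=
    (contDiffAt_const (c := (1 / 2 : ℝ))).smul (((h3.clm_apply hU).add hflip).sub
      (((ContinuousLinearMap.flipₗᵢ ℝ Plane Plane ℝ).contDiff.contDiffAt).comp t hflip))
  have h5 : ContDiffAt ℝ ∞ (fun s => christoffelAt g (γ t)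
      (extChartAt (𝓡 2) (γ t) (γ s)) (coframe (γ t) (γ s) (unitTangent g γ s))) t :=
    h2.clm_comp h4
  have h6 : ContDiffAt ℝ ∞ (deriv fun s => covectorCoords (γ t) (γ s) (α s)) t :=
    (hα.fderiv_right (m := ∞) (by simp)).clm_apply contDiffAt_const
  have h7 : ContDiffAt ℝ ∞ (dCovectorCoords g γ (γ t) α) t :=
    ((hγ.speed_inv_smoothAt ht g).smul h6).sub (ContDiffAt.clm_comp hα h5)
  refine h7.congr_of_eventuallyEq ?_
  -- Order one is chosen because smoothness of finite order at a point spreads to a neighbourhood.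
  have hd : ∀ᶠ s in 𝓝 t, DifferentiableAt ℝ (fun s => covectorCoords (γ t) (γ s) (α s)) s :=
    ((contDiffAt_infty.1 hα 1).eventually (by simp)).mono fun s hs =>
      hs.differentiableAt (by simp)
  filter_upwards [hγ.eventually_mem_source ht, hγ.mem_nhds ht, hd] with s hs hsI hds
  rw [dCovector_chart_independent g (hγ.mdifferentiableAt hsI) hs hds]
  ext w
  exact congrArg (dCovectorCoords g γ (γ t) α s) (coframe_frame hs w)

end IsRegularOn

namespace CovectorSmoothAt

variable {α β : ∀ t, Covector (γ t)} {f : ℝ → ℝ}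

lemma add (hα : CovectorSmoothAt γ α t) (hβ : CovectorSmoothAt γ β t) :
    CovectorSmoothAt γ (fun s => α s + β s) t := ContDiffAt.add hα hβ

lemma sub (hα : CovectorSmoothAt γ α t) (hβ : CovectorSmoothAt γ β t) :
    CovectorSmoothAt γ (fun s => α s - β s) t := ContDiffAt.sub hα hβ

lemma smul (hf : ContDiffAt ℝ ∞ f t) (hα : CovectorSmoothAt γ α t) :
    CovectorSmoothAt γ (fun s => f s • α s) t := ContDiffAt.smul hf hα

lemma differentiableAt (hα : CovectorSmoothAt γ α t) :
    DifferentiableAt ℝ (fun s => covectorCoords (γ t) (γ s) (α s)) t :=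
  ContDiffAt.differentiableAt hα (by simp)

end CovectorSmoothAt

lemma IsRescaling.upsilon_smoothAt {g g' : Metric M} {Ω : M → ℝ} (h : IsRescaling g g' Ω)
    (hγ : IsRegularOn γ I) (ht : t ∈ I) : CovectorSmoothAt γ (fun s => upsilon Ω (γ s)) t := by
  refine ((h.upsilonCoords_contDiffAt (mem_chart_source Plane (γ t))).comp t
    (hγ.coords_contDiffAt ht)).congr_of_eventuallyEq ?_
  filter_upwards [hγ.eventually_mem_source ht] with s hs
  exact (upsilonCoords_extChartAt Ω hs).symm

lemma IsRescaling.factor_smoothAt {g g' : Metric M} {Ω : M → ℝ} (h : IsRescaling g g' Ω)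
    (hγ : IsRegularOn γ I) (ht : t ∈ I) : ContDiffAt ℝ ∞ (fun s => Ω (γ s)) t := by
  rw [← contMDiffAt_iff_contDiffAt]
  exact h.smooth.contMDiffAt.comp _ (hγ.contMDiffAt ht)

end Smoothness

/-! ### Leibniz rules and metric compatibility along the curve -/

section Derivation

open Filter Topology

variable {M : Type*} [TopologicalSpace M] [ChartedSpace Plane M] [IsManifold (𝓡 2) ∞ M]
variable {γ : ℝ → M} {I : Set ℝ} {t : ℝ} {α β : ∀ t, Covector (γ t)} {f f₁ f₂ : ℝ → ℝ}

lemma dFun_congr (g : Metric M) (γ : ℝ → M) (h : f₁ =ᶠ[𝓝 t] f₂) :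
    dFun g γ f₁ t = dFun g γ f₂ t := by
  rw [dFun, dFun, h.deriv_eq]

lemma dFun_add (g : Metric M) (γ : ℝ → M) (h₁ : ContDiffAt ℝ ∞ f₁ t) (h₂ : ContDiffAt ℝ ∞ f₂ t) :
    dFun g γ (fun s => f₁ s + f₂ s) t = dFun g γ f₁ t + dFun g γ f₂ t := by
  have h := (h₁.differentiableAt (by simp)).hasDerivAt.add
    (h₂.differentiableAt (by simp)).hasDerivAt
  rw [dFun, dFun, dFun, show deriv (fun s => f₁ s + f₂ s) t = _ from h.deriv]
  ring

lemma dFun_sub (g : Metric M) (γ : ℝ → M) (h₁ : ContDiffAt ℝ ∞ f₁ t) (h₂ : ContDiffAt ℝ ∞ f₂ t) :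
    dFun g γ (fun s => f₁ s - f₂ s) t = dFun g γ f₁ t - dFun g γ f₂ t := by
  have h := (h₁.differentiableAt (by simp)).hasDerivAt.sub
    (h₂.differentiableAt (by simp)).hasDerivAt
  rw [dFun, dFun, dFun, show deriv (fun s => f₁ s - f₂ s) t = _ from h.deriv]
  ring

lemma dFun_mul (g : Metric M) (γ : ℝ → M) (h₁ : ContDiffAt ℝ ∞ f₁ t) (h₂ : ContDiffAt ℝ ∞ f₂ t) :
    dFun g γ (fun s => f₁ s * f₂ s) t = dFun g γ f₁ t * f₂ t + f₁ t * dFun g γ f₂ t := by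
  have h := (h₁.differentiableAt (by simp)).hasDerivAt.mul
    (h₂.differentiableAt (by simp)).hasDerivAt
  rw [dFun, dFun, dFun, show deriv (fun s => f₁ s * f₂ s) t = _ from h.deriv]
  ring

lemma dCovector_congr (g : Metric M) (h : ∀ᶠ s in 𝓝 t, α s = β s) :
    dCovector g γ α t = dCovector g γ β t := by
  have h1 : (fun s => covectorCoords (γ t) (γ s) (α s)) =ᶠ[𝓝 t]
      fun s => covectorCoords (γ t) (γ s) (β s) := h.mono fun s hs => by simp only [hs]
  rw [dCovector, dCovector, h1.deriv_eq, h.self_of_nhds]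

lemma dCovector_add (g : Metric M) (hα : CovectorSmoothAt γ α t) (hβ : CovectorSmoothAt γ β t) :
    dCovector g γ (fun s => α s + β s) t = dCovector g γ α t + dCovector g γ β t := by
  have h := (hα.differentiableAt.hasDerivAt.add hβ.differentiableAt.hasDerivAt).deriv
  have h' : deriv (fun s => covectorCoords (γ t) (γ s) (α s + β s)) t = _ := h
  simp only [dCovector, h']
  ext v
  simp [covectorCoords]
  ring

lemma dCovector_sub (g : Metric M) (hα : CovectorSmoothAt γ α t) (hβ : CovectorSmoothAt γ β t) :
    dCovector g γ (fun s => α s - β s) t = dCovector g γ α t - dCovector g γ β t := by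
  have h := (hα.differentiableAt.hasDerivAt.sub hβ.differentiableAt.hasDerivAt).deriv
  have h' : deriv (fun s => covectorCoords (γ t) (γ s) (α s - β s)) t = _ := h
  simp only [dCovector, h']
  ext v
  simp [covectorCoords]
  ring

lemma dCovector_smul (g : Metric M) (hf : ContDiffAt ℝ ∞ f t) (hα : CovectorSmoothAt γ α t) :
    dCovector g γ (fun s => f s • α s) t = dFun g γ f t • α t + f t • dCovector g γ α t := by
  have h := ((hf.differentiableAt (by simp)).hasDerivAt.smul
    hα.differentiableAt.hasDerivAt).deriv
  have h' : deriv (fun s => covectorCoords (γ t) (γ s) (f s • α s)) t = _ := h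
  ext v
  have h3 : covectorCoords (γ t) (γ t) (α t) (coframe (γ t) (γ t) v) = α t v :=
    covectorCoords_apply_coframe (mem_chart_source Plane (γ t)) _ _
  have h4 : covectorCoords (γ t) (γ t) (f t • α t) = f t • covectorCoords (γ t) (γ t) (α t) := rfl
  simp only [dCovector, h', h4, dFun, ContinuousLinearMap.comp_apply, add_apply, sub_apply,
    smul_apply, smul_eq_mul, h3]
  ring

/-- The Levi-Civita connection is compatible with the metric. -/
theorem dFun_cometric (g : Metric M) (hγ : IsRegularOn γ I) (ht : t ∈ I)
    (hα : CovectorSmoothAt γ α t) (hβ : CovectorSmoothAt γ β t) :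
    dFun g γ (fun s => cometric g (α s) (β s)) t
      = cometric g (dCovector g γ α t) (β t) + cometric g (α t) (dCovector g γ β t) := by
  have hx := mem_chart_source Plane (γ t)
  have hyt := (extChartAt_symm_eventually hx).self_of_nhds
  set y := extChartAt (𝓡 2) (γ t) (γ t) with hy
  have hv : DifferentiableAt ℝ (fun s => coframe (γ t) (γ s) (sharp g (α s))) t :=
    ContDiffAt.differentiableAt (hγ.sharp_smoothAt ht g hα) (by simp)
  have hyd := hasDerivAt_extChartAt_comp (hγ.mdifferentiableAt ht) hx
  have hG := (metricCoords_differentiableAt g hx).hasFDerivAt.comp_hasDerivAt t hyd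
  have hsrc := hγ.eventually_mem_source ht
  have h1 : (fun s => covectorCoords (γ t) (γ s) (α s)) =ᶠ[𝓝 t] fun s =>
      metricCoords g (γ t) (extChartAt (𝓡 2) (γ t) (γ s))
        (coframe (γ t) (γ s) (sharp g (α s))) := by
    filter_upwards [hsrc] with s hs
    ext w
    obtain ⟨w, rfl⟩ : ∃ w', coframe (γ t) (γ s) w' = w := ⟨_, coframe_frame hs w⟩
    rw [metricCoords_extChartAt g hs, inner_sharp, covectorCoords_apply_coframe hs]
  -- Since `α = G(α♯)` in coordinates, the derivative of `α` splits into one of `G` and one of `α♯`.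
  -- The latter matches the term `β(v')` in `hc`; what remains is `christoffelForm_add_swap`.
  have ha := h1.deriv_eq.trans (hG.clm_apply hv.hasDerivAt).deriv
  have h2 : (fun s => cometric g (α s) (β s)) =ᶠ[𝓝 t] fun s =>
      covectorCoords (γ t) (γ s) (β s) (coframe (γ t) (γ s) (sharp g (α s))) := by
    filter_upwards [hsrc] with s hs
    exact (covectorCoords_apply_coframe hs _ _).symm
  have hc := h2.deriv_eq.trans
    (hβ.differentiableAt.hasDerivAt.clm_apply hv.hasDerivAt).deriv
  set v' := deriv (fun s => coframe (γ t) (γ s) (sharp g (α s))) t with hv'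
  have hb : ∀ p, covectorCoords (γ t) (γ t) (β t) p
      = metricCoords g (γ t) y p (coframe (γ t) (γ t) (sharp g (β t))) := by
    intro p
    obtain ⟨p, rfl⟩ : ∃ w', coframe (γ t) (γ t) w' = p := ⟨_, coframe_frame hx p⟩
    rw [metricCoords_extChartAt g hx, g.symm, inner_sharp, covectorCoords_apply_coframe hx]
  have haG : ∀ p, covectorCoords (γ t) (γ t) (α t) p
      = metricCoords g (γ t) y p (coframe (γ t) (γ t) (sharp g (α t))) := by
    intro p
    obtain ⟨p, rfl⟩ : ∃ w', coframe (γ t) (γ t) w' = p := ⟨_, coframe_frame hx p⟩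
    rw [metricCoords_extChartAt g hx, g.symm, inner_sharp, covectorCoords_apply_coframe hx]
  have hU : coframe (γ t) (γ t) (unitTangent g γ t)
      = (speed g γ t)⁻¹ • coframe (γ t) (γ t) (velocity γ t) := map_smul _ _ _
  have key := christoffelForm_add_swap (metricCoords_differentiableAt g hx)
    (metricCoords_symm g (γ t)) (coframe (γ t) (γ t) (unitTangent g γ t))
    (coframe (γ t) (γ t) (sharp g (α t))) (coframe (γ t) (γ t) (sharp g (β t)))
  rw [cometric_comm g (dCovector g γ α t) (β t), dFun, hc]
  simp only [cometric, dCovector_eq, ContinuousLinearMap.comp_apply, dCovectorCoords, sub_apply,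
    smul_apply, hb, haG, metricCoords_christoffelAt g hyt, ← hy]
  rw [ha]
  rw [← hy] at key
  simp only [add_apply, smul_eq_mul, Function.comp_apply, ← hy]
  have h5 := congrArg (fun u => fderiv ℝ (metricCoords g (γ t)) y u
    (coframe (γ t) (γ t) (sharp g (α t))) (coframe (γ t) (γ t) (sharp g (β t)))) hU
  simp only [map_smul, smul_apply, smul_eq_mul] at h5
  linear_combination key + h5

lemma dFun_apply_unitTangent (g : Metric M) (hγ : IsRegularOn γ I) (ht : t ∈ I)
    (hα : CovectorSmoothAt γ α t) :
    dFun g γ (fun s => α s (unitTangent g γ s)) t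
      = dCovector g γ α t (unitTangent g γ t) + cometric g (acceleration g γ t) (α t) := by
  have h := dFun_cometric g hγ ht (hγ.tangentForm_smoothAt ht g) hα
  simp only [tangentForm_cometric] at h
  rw [h, acceleration]
  ring

lemma bilinCoords_wedge (x₀ : M) {x : M} (α β : Covector x) :
    bilinCoords x₀ x (wedge α β).1
      = (covectorCoords x₀ x α).smulRight (covectorCoords x₀ x β)
        - (covectorCoords x₀ x β).smulRight (covectorCoords x₀ x α) := rfl

lemma hasDerivAt_smulRight {a b : ℝ → Plane →L[ℝ] ℝ} {a' b' : Plane →L[ℝ] ℝ}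
    (ha : HasDerivAt a a' t) (hb : HasDerivAt b b' t) :
    HasDerivAt (fun s => (a s).smulRight (b s)) (a'.smulRight (b t) + (a t).smulRight b') t :=
  ((ContinuousLinearMap.smulRightL ℝ Plane (Plane →L[ℝ] ℝ)).hasFDerivAt.comp_hasDerivAt t
    ha).clm_apply hb

theorem dTwoForm_wedge (g : Metric M) (hα : CovectorSmoothAt γ α t)
    (hβ : CovectorSmoothAt γ β t) :
    dTwoForm g γ (fun s => wedge (α s) (β s)) t
      = wedge (dCovector g γ α t) (β t) + wedge (α t) (dCovector g γ β t) := by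
  have hx := mem_chart_source Plane (γ t)
  have ha := hα.differentiableAt.hasDerivAt
  have hb := hβ.differentiableAt.hasDerivAt
  have h := ((hasDerivAt_smulRight ha hb).sub (hasDerivAt_smulRight hb ha)).deriv
  have h' : deriv (fun s => bilinCoords (γ t) (γ s) (wedge (α s) (β s)).1) t = _ := h
  ext v w
  have h3 : ∀ (θ : Covector (γ t)) (u : TangentSpace (𝓡 2) (γ t)),
      covectorCoords (γ t) (γ t) θ (coframe (γ t) (γ t) u) = θ u :=
    fun θ u => covectorCoords_apply_coframe hx _ _
  change dBilinCoords g γ (fun s => (wedge (α s) (β s)).1) t (coframe (γ t) (γ t) v)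
    (coframe (γ t) (γ t) w) = _
  simp only [dBilinCoords]
  rw [h']
  simp only [bilinCoords_wedge]
  simp [wedge, dCovector, h3]
  ring

lemma wedge_smoothAt (hα : CovectorSmoothAt γ α t) (hβ : CovectorSmoothAt γ β t) :
    ContDiffAt ℝ ∞ (fun s => bilinCoords (γ t) (γ s) (wedge (α s) (β s)).1) t := by
  have h : ∀ {a b : ∀ t, Covector (γ t)}, CovectorSmoothAt γ a t → CovectorSmoothAt γ b t →
      ContDiffAt ℝ ∞ (fun s => (covectorCoords (γ t) (γ s) (a s)).smulRight
        (covectorCoords (γ t) (γ s) (b s))) t := fun ha hb =>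
    ((ContinuousLinearMap.smulRightL ℝ Plane
      (Plane →L[ℝ] ℝ)).contDiff.contDiffAt.comp t ha).clm_apply hb
  exact (h hα hβ).sub (h hβ hα)

end Derivation

/-! ### Orthogonality and conformal change of acceleration and jerk -/

section CurveInvariants

open Filter Topology

variable {M : Type*} [TopologicalSpace M] [ChartedSpace Plane M] [IsManifold (𝓡 2) ∞ M]
variable {γ : ℝ → M} {I : Set ℝ} {t : ℝ}

namespace IsRegularOn

lemma acceleration_smoothAt (hγ : IsRegularOn γ I) (ht : t ∈ I) (g : Metric M) :
    CovectorSmoothAt γ (acceleration g γ) t :=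
  hγ.dCovector_smoothAt ht g (hγ.tangentForm_smoothAt ht g)

lemma accelerationSq_smoothAt (hγ : IsRegularOn γ I) (ht : t ∈ I) (g : Metric M) :
    ContDiffAt ℝ ∞ (accelerationSq g γ) t :=
  hγ.cometric_smoothAt ht g (hγ.acceleration_smoothAt ht g) (hγ.acceleration_smoothAt ht g)

variable (c : MobiusStructure M) (g : c.metrics)

lemma rhoForm_smoothAt (hγ : IsRegularOn γ I) (ht : t ∈ I) :
    CovectorSmoothAt γ (rhoForm c g γ) t :=
  hγ.bilin_smoothAt ht (c.rho_smooth g) (hγ.unitTangent_smoothAt ht g.1)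

lemma rhoTangent_smoothAt (hγ : IsRegularOn γ I) (ht : t ∈ I) :
    ContDiffAt ℝ ∞ (rhoTangent c g γ) t :=
  hγ.apply_smoothAt ht (hγ.rhoForm_smoothAt c g ht) (hγ.unitTangent_smoothAt ht g.1)

lemma jerk_smoothAt (hγ : IsRegularOn γ I) (ht : t ∈ I) :
    CovectorSmoothAt γ (jerk c g γ) t :=
  ((hγ.dCovector_smoothAt ht g.1 (hγ.acceleration_smoothAt ht g.1)).add
    (CovectorSmoothAt.smul ((hγ.accelerationSq_smoothAt ht g.1).add
      (hγ.rhoTangent_smoothAt c g ht)) (hγ.tangentForm_smoothAt ht g.1))).sub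
    (hγ.rhoForm_smoothAt c g ht)

lemma tangentForm_unitTangent (hγ : IsRegularOn γ I) (ht : t ∈ I) (g : Metric M) :
    tangentForm g γ t (unitTangent g γ t) = 1 :=
  Mobius.tangentForm_unitTangent g (hγ.velocity_ne_zero t ht)

/-- Differentiate `α(U) = 0`, using `∂U = A`. Taking `α = A` and `α = J` gives the two orthogonality
facts needed for `κ`. -/
lemma dCovector_unitTangent_of_apply_eq_zero (hγ : IsRegularOn γ I) (ht : t ∈ I) (g : Metric M)
    {α : ∀ t, Covector (γ t)} (hα : CovectorSmoothAt γ α t)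
    (h : ∀ s ∈ I, α s (unitTangent g γ s) = 0) :
    dCovector g γ α t (unitTangent g γ t) = -cometric g (acceleration g γ t) (α t) := by
  have h1 := dFun_apply_unitTangent g hγ ht hα
  have h2 : (fun s => α s (unitTangent g γ s)) =ᶠ[𝓝 t] fun _ => 0 :=
    mem_of_superset (hγ.mem_nhds ht) h
  rw [dFun_congr g γ h2] at h1
  simp only [dFun, deriv_const, mul_zero] at h1
  linarith

lemma acceleration_unitTangent (hγ : IsRegularOn γ I) (ht : t ∈ I) (g : Metric M) :
    acceleration g γ t (unitTangent g γ t) = 0 := by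
  have h1 := dFun_apply_unitTangent g hγ ht (hγ.tangentForm_smoothAt ht g)
  have h2 : (fun s => tangentForm g γ s (unitTangent g γ s)) =ᶠ[𝓝 t] fun _ => 1 :=
    mem_of_superset (hγ.mem_nhds ht) fun s hs => hγ.tangentForm_unitTangent hs g
  rw [dFun_congr g γ h2, cometric_tangentForm] at h1
  simp only [dFun, deriv_const, mul_zero] at h1
  change 0 = acceleration g γ t (unitTangent g γ t) + _ at h1
  linarith

lemma jerk_unitTangent (hγ : IsRegularOn γ I) (ht : t ∈ I) :
    jerk c g γ t (unitTangent g.1 γ t) = 0 := by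
  have h := hγ.dCovector_unitTangent_of_apply_eq_zero ht g.1 (hγ.acceleration_smoothAt ht g.1)
    fun s hs => hγ.acceleration_unitTangent hs g.1
  simp only [jerk, add_apply, sub_apply, smul_apply, h, hγ.tangentForm_unitTangent ht g.1,
    accelerationSq, rhoTangent, smul_eq_mul]
  ring

lemma dCovector_jerk_unitTangent (hγ : IsRegularOn γ I) (ht : t ∈ I) :
    dCovector g.1 γ (jerk c g γ) t (unitTangent g.1 γ t)
      = -cometric g.1 (acceleration g.1 γ t) (jerk c g γ t) :=
  hγ.dCovector_unitTangent_of_apply_eq_zero ht g.1 (hγ.jerk_smoothAt c g ht)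
    fun _ hs => hγ.jerk_unitTangent c g hs

end IsRegularOn

lemma dFun_factor {g g' : Metric M} {Ω : M → ℝ} (h : IsRescaling g g' Ω) (g₀ : Metric M)
    (hγ : IsRegularOn γ I) (ht : t ∈ I) :
    dFun g₀ γ (fun s => Ω (γ s)) t = Ω (γ t) * upsilon Ω (γ t) (unitTangent g₀ γ t) := by
  have hx := mem_chart_source Plane (γ t)
  have h1 := (((h.funCoords_contDiffAt hx).differentiableAt (by simp)).hasFDerivAt.comp_hasDerivAt
    t (hasDerivAt_extChartAt_comp (hγ.mdifferentiableAt ht) hx)).deriv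
  have h2 : (fun s => Ω (γ s)) =ᶠ[𝓝 t]
      funCoords Ω (γ t) ∘ fun s => extChartAt (𝓡 2) (γ t) (γ s) := by
    filter_upwards [hγ.eventually_mem_source ht] with s hs
    simp only [Function.comp_apply, funCoords]
    rw [extChartAt_left_inv hs]
  rw [dFun, h2.deriv_eq, h1, h.fderiv_funCoords hx, frame_coframe hx, unitTangent, map_smul,
    smul_eq_mul]
  ring

section Rescaling

variable {c : MobiusStructure M} {g g' : c.metrics} {Ω : M → ℝ}

lemma IsRescaling.upsilonTangent_smoothAt (h : IsRescaling g.1 g'.1 Ω) (hγ : IsRegularOn γ I)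
    (ht : t ∈ I) :
    ContDiffAt ℝ ∞ (fun s => upsilon Ω (γ s) (unitTangent g.1 γ s)) t :=
  hγ.apply_smoothAt ht (h.upsilon_smoothAt hγ ht) (hγ.unitTangent_smoothAt ht g.1)

lemma IsRescaling.acceleration_eq {g g' : Metric M} (h : IsRescaling g g' Ω)
    (hγ : IsRegularOn γ I) (ht : t ∈ I) :
    acceleration g' γ t = acceleration g γ t - upsilon Ω (γ t)
      + upsilon Ω (γ t) (unitTangent g γ t) • tangentForm g γ t := by
  have hΩ := (h.pos (γ t)).ne'
  have h1 : tangentForm g' γ = fun s => Ω (γ s) • tangentForm g γ s :=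
    funext fun s => h.tangentForm_eq γ s
  rw [acceleration, h.dCovector_eq, h1,
    dCovector_smul g (h.factor_smoothAt hγ ht) (hγ.tangentForm_smoothAt ht g),
    dFun_factor h g hγ ht, ← acceleration, cometric_smul, cometric_tangentForm, smul_apply,
    hγ.tangentForm_unitTangent ht g]
  ext w
  simp only [smul_apply, add_apply, sub_apply, smul_eq_mul]
  field_simp
  ring

lemma IsRescaling.accelerationSq_eq {g g' : Metric M} (h : IsRescaling g g' Ω)
    (hγ : IsRegularOn γ I) (ht : t ∈ I) :
    accelerationSq g' γ t = (Ω (γ t) ^ 2)⁻¹ * (accelerationSq g γ t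
      - 2 * cometric g (acceleration g γ t) (upsilon Ω (γ t))
      + cometric g (upsilon Ω (γ t)) (upsilon Ω (γ t))
      - upsilon Ω (γ t) (unitTangent g γ t) ^ 2) := by
  rw [accelerationSq, h.cometric_eq, h.acceleration_eq hγ ht]
  simp only [cometric_add, cometric_sub, cometric_smul, add_cometric, sub_cometric, smul_cometric,
    tangentForm_cometric, cometric_tangentForm, add_apply, sub_apply, smul_apply, smul_eq_mul,
    hγ.acceleration_unitTangent ht g,
    hγ.tangentForm_unitTangent ht g, accelerationSq,
    cometric_comm g (upsilon Ω (γ t)) (acceleration g γ t)]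
  ring

lemma IsRescaling.rhoForm_eq (h : IsRescaling g.1 g'.1 Ω) (hγ : IsRegularOn γ I) (ht : t ∈ I) :
    rhoForm c g' γ t = (Ω (γ t))⁻¹ • (rhoForm c g γ t
      - dCovector g.1 γ (fun s => upsilon Ω (γ s)) t
      + upsilon Ω (γ t) (unitTangent g.1 γ t) • upsilon Ω (γ t)
      - (1 / 2 * cometric g.1 (upsilon Ω (γ t)) (upsilon Ω (γ t))) • tangentForm g.1 γ t) := by
  ext w
  have h1 := c.rho_rescale g g' Ω h (γ t) (unitTangent g.1 γ t) w
  rw [rhoForm, h.unitTangent_eq, map_smul, smul_apply, h1]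
  simp only [smul_apply, add_apply, sub_apply, smul_eq_mul,
    h.dCovector_upsilon g.1 (hγ.mdifferentiableAt ht)]
  rfl

lemma IsRescaling.rhoTangent_eq (h : IsRescaling g.1 g'.1 Ω) (hγ : IsRegularOn γ I)
    (ht : t ∈ I) :
    rhoTangent c g' γ t = (Ω (γ t) ^ 2)⁻¹ * (rhoTangent c g γ t
      - dCovector g.1 γ (fun s => upsilon Ω (γ s)) t (unitTangent g.1 γ t)
      + upsilon Ω (γ t) (unitTangent g.1 γ t) ^ 2
      - 1 / 2 * cometric g.1 (upsilon Ω (γ t)) (upsilon Ω (γ t))) := by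
  rw [rhoTangent, h.rhoForm_eq hγ ht, h.unitTangent_eq, map_smul]
  simp only [smul_apply, add_apply, sub_apply, smul_eq_mul, hγ.tangentForm_unitTangent ht g.1,
    rhoTangent]
  have hΩ := (h.pos (γ t)).ne'
  field_simp

lemma IsRescaling.dCovector_acceleration (h : IsRescaling g.1 g'.1 Ω) (hγ : IsRegularOn γ I)
    (ht : t ∈ I) :
    dCovector g.1 γ (acceleration g'.1 γ) t
      = dCovector g.1 γ (acceleration g.1 γ) t - dCovector g.1 γ (fun s => upsilon Ω (γ s)) t
        + (dCovector g.1 γ (fun s => upsilon Ω (γ s)) t (unitTangent g.1 γ t)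
          + cometric g.1 (acceleration g.1 γ t) (upsilon Ω (γ t))) • tangentForm g.1 γ t
        + upsilon Ω (γ t) (unitTangent g.1 γ t) • acceleration g.1 γ t := by
  have h1 : ∀ᶠ s in 𝓝 t, acceleration g'.1 γ s = acceleration g.1 γ s - upsilon Ω (γ s)
      + upsilon Ω (γ s) (unitTangent g.1 γ s) • tangentForm g.1 γ s :=
    mem_of_superset (hγ.mem_nhds ht) fun s hs => h.acceleration_eq hγ hs
  have hA := hγ.acceleration_smoothAt ht g.1
  have hΥ := h.upsilon_smoothAt hγ ht
  have hU := hγ.tangentForm_smoothAt ht g.1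
  have hu := h.upsilonTangent_smoothAt hγ ht
  rw [dCovector_congr g.1 h1, dCovector_add g.1 (hA.sub hΥ) (CovectorSmoothAt.smul hu hU),
    dCovector_sub g.1 hA hΥ, dCovector_smul g.1 hu hU, dFun_apply_unitTangent g.1 hγ ht hΥ,
    ← acceleration, add_assoc]

/-- The `-∂Υ` coming from `∂A'` cancels the one in the law for `P`, and the correction along `U` in
the definition of `J` absorbs the remaining tangential terms. -/
lemma IsRescaling.jerk_eq (h : IsRescaling g.1 g'.1 Ω) (hγ : IsRegularOn γ I) (ht : t ∈ I) :
    jerk c g' γ t = (Ω (γ t))⁻¹ • jerk c g γ t := by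
  have hΩ := (h.pos (γ t)).ne'
  -- The new unit tangent is a multiple of the old one, so `A'` annihilates both; this removes the
  -- `α(U) Υ` term of the conformal change.
  have hA0 : acceleration g'.1 γ t (unitTangent g.1 γ t) = 0 := by
    have := hγ.acceleration_unitTangent ht g'.1
    rw [h.unitTangent_eq, map_smul, smul_eq_mul] at this
    exact (mul_eq_zero.1 this).resolve_left (inv_ne_zero hΩ)
  rw [jerk, h.dCovector_eq, h.dCovector_acceleration hγ ht, hA0, h.acceleration_eq hγ ht,
    h.accelerationSq_eq hγ ht, h.rhoForm_eq hγ ht, h.rhoTangent_eq hγ ht, h.tangentForm_eq]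
  ext w
  simp only [jerk, smul_apply, add_apply, sub_apply, smul_eq_mul, cometric_add, cometric_sub,
    cometric_smul, cometric_tangentForm,
    cometric_comm g.1 (upsilon Ω (γ t)) (acceleration g.1 γ t)]
  field_simp
  ring

lemma IsRescaling.dCovector_jerk (h : IsRescaling g.1 g'.1 Ω) (hγ : IsRegularOn γ I)
    (ht : t ∈ I) :
    dCovector g'.1 γ (jerk c g' γ) t = (Ω (γ t) ^ 2)⁻¹ • (dCovector g.1 γ (jerk c g γ) t
      - (2 * upsilon Ω (γ t) (unitTangent g.1 γ t)) • jerk c g γ t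
      + cometric g.1 (upsilon Ω (γ t)) (jerk c g γ t) • tangentForm g.1 γ t) := by
  have hΩ := (h.pos (γ t)).ne'
  have hΩs := h.factor_smoothAt hγ ht
  have hJ' : CovectorSmoothAt γ (jerk c g' γ) t := hγ.jerk_smoothAt c g' ht
  -- Writing `J = Ω J'` rather than `J' = Ω⁻¹ J` avoids differentiating an inverse.
  have h1 : ∀ᶠ s in 𝓝 t, jerk c g γ s = Ω (γ s) • jerk c g' γ s :=
    mem_of_superset (hγ.mem_nhds ht) fun s hs => by
      change jerk c g γ s = Ω (γ s) • jerk c g' γ s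
      rw [h.jerk_eq hγ hs, smul_smul, mul_inv_cancel₀ (h.pos _).ne', one_smul]
  have h2 := dCovector_congr g.1 h1
  rw [dCovector_smul g.1 hΩs hJ', dFun_factor h g.1 hγ ht] at h2
  have h3 : dCovector g.1 γ (jerk c g' γ) t = (Ω (γ t))⁻¹ • (dCovector g.1 γ (jerk c g γ) t
      - (Ω (γ t) * upsilon Ω (γ t) (unitTangent g.1 γ t)) • jerk c g' γ t) := by
    rw [h2, add_sub_cancel_left, smul_smul, inv_mul_cancel₀ hΩ, one_smul]
  rw [h.dCovector_eq, h3, h.jerk_eq hγ ht]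
  ext w
  simp only [smul_apply, add_apply, sub_apply, smul_eq_mul, cometric_smul,
    hγ.jerk_unitTangent c g ht]
  field_simp
  ring

end Rescaling

end CurveInvariants

/-! ### The function `κ`, and weights of the lift and the loxodrome expression -/

section Kappa

open Filter Topology

variable {M : Type*} [TopologicalSpace M] [ChartedSpace Plane M] [IsManifold (𝓡 2) ∞ M]
variable {γ : ℝ → M} {I : Set ℝ} {t : ℝ}

/-- On a surface, covectors annihilating a common nonzero vector are proportional. -/
lemma eq_smul_of_apply_eq_zero (g : Metric M) {x : M} {u : TangentSpace (𝓡 2) x} (hu : u ≠ 0)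
    {α β : Covector x} (hα : α u = 0) (hβ : β u = 0) (hα0 : α ≠ 0) :
    β = (cometric g β α / cometric g α α) • α := by
  let φ : (Plane →L[ℝ] ℝ) →ₗ[ℝ] ℝ := (ContinuousLinearMap.apply ℝ ℝ (show Plane from u)).toLinearMap
  have hdim : Module.finrank ℝ (Plane →L[ℝ] ℝ) = 2 := by
    rw [← (LinearMap.toContinuousLinearMap (𝕜 := ℝ) (E := Plane) (F' := ℝ)).finrank_eq]
    refine (Subspace.dual_finrank_eq (K := ℝ) (V := Plane)).trans ?_
    simp
  -- Evaluation at `u` is onto because `g(u, u) ≠ 0`; rank-nullity then makes its kernel a line.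
  have hsurj : LinearMap.range φ = ⊤ := by
    rw [LinearMap.range_eq_top]
    intro r
    have hpos := g.pos x u hu
    refine ⟨(show Plane →L[ℝ] ℝ from (r / g.inner x u u) • g.inner x u), ?_⟩
    exact div_mul_cancel₀ r hpos.ne'
  have hker : Module.finrank ℝ (LinearMap.ker φ) = 1 := by
    have h := LinearMap.finrank_range_add_finrank_ker φ
    rw [hsurj, finrank_top, hdim] at h
    simp at h
    omega
  obtain ⟨r, hr⟩ := exists_smul_eq_of_finrank_eq_one hker
    (x := (⟨α, hα⟩ : LinearMap.ker φ)) (fun h => hα0 (congrArg Subtype.val h)) ⟨β, hβ⟩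
  have hr' : r • α = β := congrArg Subtype.val hr
  rw [← hr', smul_cometric, mul_div_assoc, div_self (cometric_pos g hα0).ne', mul_one]

variable (c : MobiusStructure M)

/-- The solution of `∂ J_b + A^c J_c U_b + 2 κ J_b = 0`. -/
def kappa (γ : ℝ → M) (g : c.metrics) (t : ℝ) : ℝ :=
  -(1 / 2) * (cometric g.1 (dCovector g.1 γ (jerk c g γ) t) (jerk c g γ t)
    / cometric g.1 (jerk c g γ t) (jerk c g γ t))

variable {c} {g g' : c.metrics} {Ω : M → ℝ}

lemma unitTangent_ne_zero (hγ : IsRegularOn γ I) (ht : t ∈ I) (g : Metric M) :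
    unitTangent g γ t ≠ 0 := fun h => by
  have := hγ.tangentForm_unitTangent ht g
  rw [h, map_zero] at this
  exact zero_ne_one this

lemma kappa_smoothAt (hγ : IsRegularOn γ I) (ht : t ∈ I) (hJ : jerk c g γ t ≠ 0) :
    ContDiffAt ℝ ∞ (kappa c γ g) t := by
  have hJs := hγ.jerk_smoothAt c g ht
  exact contDiffAt_const.mul ((hγ.cometric_smoothAt ht g.1 (hγ.dCovector_smoothAt ht g.1 hJs)
    hJs).div (hγ.cometric_smoothAt ht g.1 hJs hJs) (cometric_pos g.1 hJ).ne')

lemma kappa_spec (hγ : IsRegularOn γ I) (ht : t ∈ I) (hJ : jerk c g γ t ≠ 0) :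
    dCovector g.1 γ (jerk c g γ) t
      + cometric g.1 (acceleration g.1 γ t) (jerk c g γ t) • tangentForm g.1 γ t
      + (2 * kappa c γ g t) • jerk c g γ t = 0 := by
  have hJU := hγ.jerk_unitTangent c g ht
  have hβ : (dCovector g.1 γ (jerk c g γ) t
      + cometric g.1 (acceleration g.1 γ t) (jerk c g γ t) • tangentForm g.1 γ t)
        (unitTangent g.1 γ t) = 0 := by
    rw [add_apply, smul_apply, hγ.tangentForm_unitTangent ht, hγ.dCovector_jerk_unitTangent c g ht,
      smul_eq_mul]
    ring
  have h := eq_smul_of_apply_eq_zero g.1 (unitTangent_ne_zero hγ ht g.1) hJU hβ hJ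
  rw [add_cometric, smul_cometric, tangentForm_cometric, hJU, mul_zero, add_zero] at h
  rw [h, ← add_smul, kappa]
  convert zero_smul ℝ (jerk c g γ t) using 2
  ring

lemma kappa_unique {α β : Covector (γ t)} {r r' : ℝ} (hα : α ≠ 0)
    (h : β + (2 * r) • α = 0) (h' : β + (2 * r') • α = 0) : r = r' := by
  have h2 := smul_left_injective ℝ hα (add_left_cancel (h.trans h'.symm))
  simpa using h2

/-- Multiplied by `Ω`, the primed equation takes the form `β + 2 r J = 0` with the unprimed `J`.
Expanding `β` cancels the `⟨Υ, J⟩ U` terms and leaves `-2 Υ(U) J`, which is the shift of `κ`. -/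
lemma kappa_rescale (h : IsRescaling g.1 g'.1 Ω) (hγ : IsRegularOn γ I) (ht : t ∈ I)
    (hJ : jerk c g γ t ≠ 0) {κ κ' : ℝ}
    (hκ : dCovector g.1 γ (jerk c g γ) t
      + cometric g.1 (acceleration g.1 γ t) (jerk c g γ t) • tangentForm g.1 γ t
      + (2 * κ) • jerk c g γ t = 0)
    (hκ' : dCovector g'.1 γ (jerk c g' γ) t
      + cometric g'.1 (acceleration g'.1 γ t) (jerk c g' γ t) • tangentForm g'.1 γ t
      + (2 * κ') • jerk c g' γ t = 0) :
    κ' = (Ω (γ t))⁻¹ * (κ + upsilon Ω (γ t) (unitTangent g.1 γ t)) := by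
  have hΩ := (h.pos (γ t)).ne'
  refine kappa_unique hJ (β := Ω (γ t) • (dCovector g'.1 γ (jerk c g' γ) t
    + cometric g'.1 (acceleration g'.1 γ t) (jerk c g' γ t) • tangentForm g'.1 γ t)) ?_ ?_
  · have h1 := congrArg (fun α => Ω (γ t) • α) hκ'
    have h2 : jerk c g γ t = Ω (γ t) • jerk c g' γ t := by
      rw [h.jerk_eq hγ ht, smul_smul, mul_inv_cancel₀ hΩ, one_smul]
    rw [smul_zero] at h1
    rw [h2, smul_comm (2 * κ'), ← smul_add]
    exact h1
  · rw [h.dCovector_jerk hγ ht, h.jerk_eq hγ ht, h.acceleration_eq hγ ht, h.cometric_eq,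
      h.tangentForm_eq]
    have h1 := congrArg (fun α => (Ω (γ t))⁻¹ • α) hκ
    simp only [smul_zero] at h1
    rw [← h1]
    ext w
    simp only [smul_apply, add_apply, sub_apply, smul_eq_mul, cometric_smul, add_cometric,
      sub_cometric, smul_cometric, tangentForm_cometric, hγ.jerk_unitTangent c g ht]
    field_simp
    ring

lemma lift_rescale (h : IsRescaling g.1 g'.1 Ω) (hγ : IsRegularOn γ I) (ht : t ∈ I)
    {κ κ' : ℝ → ℝ}
    (hκ : κ' t = (Ω (γ t))⁻¹ * (κ t + upsilon Ω (γ t) (unitTangent g.1 γ t))) :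
    lift c g' γ κ' t = (Ω (γ t))⁻¹ • rescale g.1 Ω (γ t) (lift c g γ κ t) := by
  have hΩ := (h.pos (γ t)).ne'
  refine Prod.ext ?_ (Prod.ext ?_ (Prod.ext ?_ ?_))
  · simp only [lift, rescale, Prod.smul_fst, h.tangentForm_eq, smul_smul]
    congr 1
    field_simp
  · ext v w
    simp only [lift, rescale, Prod.smul_snd, Prod.smul_fst, h.tangentForm_eq,
      h.acceleration_eq hγ ht, wedge]
    simp
    field_simp
    ring
  · simp only [lift, rescale, Prod.smul_snd, Prod.smul_fst, hκ, cometric_tangentForm, smul_eq_mul]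
  · ext w
    have hμ : ((lift c g γ κ t).2.1.1 (sharp g.1 (upsilon Ω (γ t)))) w
        = upsilon Ω (γ t) (unitTangent g.1 γ t) * acceleration g.1 γ t w
          - cometric g.1 (acceleration g.1 γ t) (upsilon Ω (γ t)) * tangentForm g.1 γ t w := by
      rw [cometric_comm, ← cometric_tangentForm g.1 (upsilon Ω (γ t))]
      rfl
    simp only [rescale, Prod.smul_snd, smul_apply, add_apply, sub_apply, smul_eq_mul, hμ]
    simp only [lift, smul_apply, add_apply, sub_apply, smul_eq_mul, hκ, h.jerk_eq hγ ht,
      h.accelerationSq_eq hγ ht, h.acceleration_eq hγ ht, h.tangentForm_eq, cometric_tangentForm]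
    field_simp
    ring

/-- Differentiating `Ω κ' = κ + Υ(U)` produces `(∂Υ)(U) + ⟨A, Υ⟩`; the first term cancels against
the change of `P(U, U)`, the second against that of `½ |A|²`, and the quadratic terms in `Υ` sum to
zero. -/
lemma loxodromeExpr_rescale (h : IsRescaling g.1 g'.1 Ω) (hγ : IsRegularOn γ I) (ht : t ∈ I)
    {κ κ' : ℝ → ℝ} (hκs : ContDiffAt ℝ ∞ κ t) (hκs' : ContDiffAt ℝ ∞ κ' t)
    (hκ : ∀ s ∈ I, κ' s = (Ω (γ s))⁻¹ * (κ s + upsilon Ω (γ s) (unitTangent g.1 γ s))) :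
    loxodromeExpr c g' γ κ' t = (Ω (γ t) ^ 2)⁻¹ * loxodromeExpr c g γ κ t := by
  have hΩ := (h.pos (γ t)).ne'
  have hu := h.upsilonTangent_smoothAt hγ ht
  have h1 : (fun s => Ω (γ s) * κ' s) =ᶠ[𝓝 t]
      fun s => κ s + upsilon Ω (γ s) (unitTangent g.1 γ s) :=
    mem_of_superset (hγ.mem_nhds ht) fun s hs => by
      change Ω (γ s) * κ' s = _
      rw [hκ s hs, mul_inv_cancel_left₀ (h.pos _).ne']
  have h2 := dFun_congr g.1 γ h1
  rw [dFun_mul g.1 γ (h.factor_smoothAt hγ ht) hκs', dFun_add g.1 γ hκs hu,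
    dFun_factor h g.1 hγ ht, dFun_apply_unitTangent g.1 hγ ht (h.upsilon_smoothAt hγ ht)] at h2
  have h3 : dFun g.1 γ κ' t = (Ω (γ t))⁻¹ * (dFun g.1 γ κ t
      + (dCovector g.1 γ (fun s => upsilon Ω (γ s)) t (unitTangent g.1 γ t)
        + cometric g.1 (acceleration g.1 γ t) (upsilon Ω (γ t)))
      - Ω (γ t) * upsilon Ω (γ t) (unitTangent g.1 γ t) * κ' t) := by
    rw [← h2, add_sub_cancel_left, inv_mul_cancel_left₀ hΩ]
  simp only [loxodromeExpr]
  rw [h.dFun_eq, h3, h.accelerationSq_eq hγ ht, h.rhoTangent_eq hγ ht, hκ t ht]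
  field_simp
  ring

end Kappa

/-! ### The tractor derivative of multiples of the lift -/

section TractorDerivative

open Filter Topology

variable {M : Type*} [TopologicalSpace M] [ChartedSpace Plane M] [IsManifold (𝓡 2) ∞ M]
variable {γ : ℝ → M} {I : Set ℝ} {t : ℝ} {c : MobiusStructure M}

lemma dTractor_congr (g : c.metrics) {s s' : ∀ t, TractorInScale (γ t)}
    (h : ∀ᶠ r in 𝓝 t, s r = s' r) : dTractor c g γ s t = dTractor c g γ s' t := by
  have h1 : dCovector g.1 γ (fun r => (s r).1) t = dCovector g.1 γ (fun r => (s' r).1) t :=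
    dCovector_congr g.1 (h.mono fun r hr => by rw [hr])
  have h2 : dCovector g.1 γ (fun r => (s r).2.2.2) t = dCovector g.1 γ (fun r => (s' r).2.2.2) t :=
    dCovector_congr g.1 (h.mono fun r hr => by rw [hr])
  have h3 : dFun g.1 γ (fun r => (s r).2.2.1) t = dFun g.1 γ (fun r => (s' r).2.2.1) t :=
    dFun_congr g.1 γ (h.mono fun r hr => by simp only [hr])
  have h4 : dTwoForm g.1 γ (fun r => (s r).2.1) t = dTwoForm g.1 γ (fun r => (s' r).2.1) t := by
    have h5 : (fun r => bilinCoords (γ t) (γ r) (s r).2.1.1) =ᶠ[𝓝 t]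
        fun r => bilinCoords (γ t) (γ r) (s' r).2.1.1 := h.mono fun r hr => by simp only [hr]
    apply Subtype.ext
    simp only [dTwoForm, dBilinCoords, h5.deriv_eq, h.self_of_nhds]
  simp only [dTractor, h1, h2, h3, h4, h.self_of_nhds]

/-- The tractor derivative of a multiple of the lift of the unit tangent. -/
theorem dTractor_smul_lift (g : c.metrics) (hγ : IsRegularOn γ I) (ht : t ∈ I)
    {a κ : ℝ → ℝ} (ha : ContDiffAt ℝ ∞ a t) (hκs : ContDiffAt ℝ ∞ κ t)
    (hκ : dCovector g.1 γ (jerk c g γ) t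
      + cometric g.1 (acceleration g.1 γ t) (jerk c g γ t) • tangentForm g.1 γ t
      + (2 * κ t) • jerk c g γ t = 0) :
    dTractor c g γ (fun r => a r • lift c g γ κ r) t
      = (dFun g.1 γ a t - κ t * a t) • lift c g γ κ t
        + (a t * loxodromeExpr c g γ κ t) •
          (0, 0, 1, acceleration g.1 γ t - κ t • tangentForm g.1 γ t) := by
  have hU := hγ.tangentForm_smoothAt ht g.1
  have hA := hγ.acceleration_smoothAt ht g.1
  have hJ : CovectorSmoothAt γ (jerk c g γ) t := hγ.jerk_smoothAt c g ht
  have hUU := hγ.tangentForm_unitTangent ht g.1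
  have hAU := hγ.acceleration_unitTangent ht g.1
  have hJU := hγ.jerk_unitTangent c g ht
  have hA2 := hγ.accelerationSq_smoothAt ht g.1
  -- The definition of `J` and the equation for `κ` serve as structure equations for `∂A` and `∂J`.
  -- In the last slot, `-2κ J` from `∂J` and `κ J` from `κ ∂A` add to `-κ J`, matching the factor
  -- `-κ` of the first slot.
  have hdA : dCovector g.1 γ (acceleration g.1 γ) t = jerk c g γ t
      - (accelerationSq g.1 γ t + rhoTangent c g γ t) • tangentForm g.1 γ t
      + rhoForm c g γ t := by
    rw [jerk]; abel
  have hdJ : dCovector g.1 γ (jerk c g γ) t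
      = -(cometric g.1 (acceleration g.1 γ t) (jerk c g γ t) • tangentForm g.1 γ t)
        - (2 * κ t) • jerk c g γ t := by
    rw [← sub_eq_zero, ← hκ]; abel
  have hdA2 : dFun g.1 γ (accelerationSq g.1 γ) t
      = 2 * (cometric g.1 (acceleration g.1 γ t) (jerk c g γ t)
        + cometric g.1 (acceleration g.1 γ t) (rhoForm c g γ t)) := by
    have h := dFun_cometric g.1 hγ ht hA hA
    rw [hdA, cometric_comm g.1 _ (acceleration g.1 γ t), cometric_add, cometric_sub, cometric_smul,
      cometric_tangentForm, hAU] at h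
    exact h.trans (by ring)
  have hcoef : ContDiffAt ℝ ∞ (fun r => 1 / 2 * (accelerationSq g.1 γ r - κ r ^ 2)) t :=
    contDiffAt_const.mul (hA2.sub (hκs.pow 2))
  have hdcoef : dFun g.1 γ (fun r => 1 / 2 * (accelerationSq g.1 γ r - κ r ^ 2)) t
      = 1 / 2 * dFun g.1 γ (accelerationSq g.1 γ) t - κ t * dFun g.1 γ κ t := by
    have h1 : (fun r => 1 / 2 * (accelerationSq g.1 γ r - κ r ^ 2))
        = fun r => 1 / 2 * (accelerationSq g.1 γ r - κ r * κ r) := by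
      funext r; ring
    have h2 := dFun_mul g.1 γ (f₁ := fun _ => (1 / 2 : ℝ)) contDiffAt_const
      (hA2.sub (hκs.mul hκs))
    have h3 := dFun_sub g.1 γ hA2 (hκs.mul hκs)
    have h4 := dFun_mul g.1 γ hκs hκs
    have h5 : dFun g.1 γ (fun _ => (1 / 2 : ℝ)) t = 0 := by simp [dFun]
    rw [h1]
    refine h2.trans ?_
    rw [h5]
    refine Eq.trans (congrArg (fun z => 0 * _ + 1 / 2 * z) (h3.trans (congrArg _ h4))) ?_
    ring
  have hρ : CovectorSmoothAt γ (fun r => (lift c g γ κ r).2.2.2) t :=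
    (hJ.add (CovectorSmoothAt.smul hcoef hU)).add (CovectorSmoothAt.smul hκs hA)
  have hdρ : dCovector g.1 γ (fun r => (lift c g γ κ r).2.2.2) t
      = dCovector g.1 γ (jerk c g γ) t
        + ((cometric g.1 (acceleration g.1 γ t) (jerk c g γ t)
            + cometric g.1 (acceleration g.1 γ t) (rhoForm c g γ t) - κ t * dFun g.1 γ κ t) •
              tangentForm g.1 γ t
          + (1 / 2 * (accelerationSq g.1 γ t - κ t ^ 2)) • acceleration g.1 γ t)
        + (dFun g.1 γ κ t • acceleration g.1 γ t
          + κ t • dCovector g.1 γ (acceleration g.1 γ) t) := by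
    have h1 := dCovector_add g.1 (hJ.add (CovectorSmoothAt.smul hcoef hU))
      (CovectorSmoothAt.smul hκs hA)
    rw [dCovector_add g.1 hJ (CovectorSmoothAt.smul hcoef hU), dCovector_smul g.1 hcoef hU,
      dCovector_smul g.1 hκs hA, hdcoef, hdA2, ← acceleration] at h1
    refine h1.trans ?_
    congr 4
    ring
  have hdU : dCovector g.1 γ (tangentForm g.1 γ) t = acceleration g.1 γ t := rfl
  refine Prod.ext ?_ (Prod.ext ?_ (Prod.ext ?_ ?_))
  · have h1 : dCovector g.1 γ (fun r => (a r • lift c g γ κ r).1) t = _ :=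
      dCovector_smul g.1 ha hU
    simp only [dTractor, h1]
    ext w
    simp [lift, wedge, hUU, hAU, show dCovector g.1 γ (fun r => tangentForm g.1 γ r) t = _ from hdU]
    ring
  · have h1 : (fun r => (a r • lift c g γ κ r).2.1)
        = fun r => wedge (tangentForm g.1 γ r) (a r • acceleration g.1 γ r) := by
      funext r
      rw [wedge_smul]
      rfl
    simp only [dTractor]
    rw [h1, dTwoForm_wedge g.1 hU (CovectorSmoothAt.smul ha hA), dCovector_smul g.1 ha hA, hdA]
    ext v w
    simp [lift, wedge, hdU]
    ring
  · have h1 : dFun g.1 γ (fun r => (a r • lift c g γ κ r).2.2.1) t = _ :=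
      dFun_mul g.1 γ ha hκs
    simp only [dTractor, h1]
    simp [lift, hUU, hAU, hJU, cometric_tangentForm, loxodromeExpr, cometric_smul]
    rw [← rhoTangent]
    ring
  · have h1 : dCovector g.1 γ (fun r => (a r • lift c g γ κ r).2.2.2) t = _ :=
      dCovector_smul g.1 ha hρ
    simp only [dTractor, h1, hdρ, hdJ, hdA]
    ext w
    have hμ : ((a t • lift c g γ κ t).2.1.1 (sharp g.1 (rhoForm c g γ t))) w
        = a t * (rhoTangent c g γ t * acceleration g.1 γ t w
          - cometric g.1 (acceleration g.1 γ t) (rhoForm c g γ t) * tangentForm g.1 γ t w) := by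
      rw [cometric_comm, rhoTangent, ← cometric_tangentForm g.1 (rhoForm c g γ t)]
      rfl
    simp only [add_apply, sub_apply, smul_apply, hμ]
    simp [lift, loxodromeExpr]
    ring

end TractorDerivative

/-! ### The line subbundle and when it is preserved -/

section CanonicalLine

open Filter Topology

variable {M : Type*} [TopologicalSpace M] [ChartedSpace Plane M] [IsManifold (𝓡 2) ∞ M]
variable {γ : ℝ → M} {I : Set ℝ} {t : ℝ} {c : MobiusStructure M}

/-- A function `κ` for each metric of the class, smooth along the curve and transforming by
`κ' = Ω⁻¹ (κ + Υ_a U^a)`. -/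
structure IsKappaFamily (c : MobiusStructure M) (γ : ℝ → M) (I : Set ℝ)
    (κ : c.metrics → ℝ → ℝ) : Prop where
  defines : DefinesKappa c γ I κ
  smooth : ∀ g, ∀ t ∈ I, ContDiffAt ℝ ∞ (κ g) t
  rescaling : ∀ (g g' : c.metrics) (Ω : M → ℝ), IsRescaling g.1 g'.1 Ω → ∀ t ∈ I,
    κ g' t = (Ω (γ t))⁻¹ * (κ g t + upsilon Ω (γ t) (unitTangent g.1 γ t))

lemma exists_rescaling (g g' : c.metrics) : ∃ Ω : M → ℝ, IsRescaling g.1 g'.1 Ω :=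
  (c.mem_iff g.1 g.2 g'.1).1 g'.2

lemma jerk_ne_zero (hγ : IsRegularOn γ I) {g : c.metrics} (hJ : ∀ t ∈ I, jerk c g γ t ≠ 0)
    (g' : c.metrics) (ht : t ∈ I) : jerk c g' γ t ≠ 0 := by
  obtain ⟨Ω, h⟩ := exists_rescaling g g'
  rw [h.jerk_eq hγ ht]
  exact smul_ne_zero (inv_ne_zero (h.pos _).ne') (hJ t ht)

lemma DefinesKappa.eq_kappa (hγ : IsRegularOn γ I)
    (hJ : ∀ (g : c.metrics), ∀ t ∈ I, jerk c g γ t ≠ 0) {κ : c.metrics → ℝ → ℝ}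
    (hκ : DefinesKappa c γ I κ) (g : c.metrics) (ht : t ∈ I) : κ g t = kappa c γ g t :=
  kappa_unique (hJ g t ht) (hκ g t ht) (kappa_spec hγ ht (hJ g t ht))

lemma DefinesKappa.isKappaFamily (hγ : IsRegularOn γ I)
    (hJ : ∀ (g : c.metrics), ∀ t ∈ I, jerk c g γ t ≠ 0) {κ : c.metrics → ℝ → ℝ}
    (hκ : DefinesKappa c γ I κ) : IsKappaFamily c γ I κ where
  defines := hκ
  smooth g t ht := (kappa_smoothAt hγ ht (hJ g t ht)).congr_of_eventuallyEq
    (mem_of_superset (hγ.mem_nhds ht) fun _ hs => hκ.eq_kappa hγ hJ g hs)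
  rescaling g g' _ h t ht := kappa_rescale h hγ ht (hJ g t ht) (hκ g t ht) (hκ g' t ht)

variable {κ : c.metrics → ℝ → ℝ}

lemma mem_canonicalLine {w : ℤ} {s : c.metrics → TractorInScale (γ t)} :
    s ∈ canonicalLine c γ κ w t ↔ s ∈ AdjointTractor c w (γ t) ∧
      ∀ g, ∃ a : ℝ, a • lift c g γ (κ g) t = s g := by
  simp [canonicalLine, Submodule.mem_span_singleton]

/-- A section of the canonical line in `𝒜`, given the factors relating a fixed metric of the class
to all metrics of the class. -/
def generator (γ : ℝ → M) (κ : c.metrics → ℝ → ℝ) (Φ : c.metrics → M → ℝ) (t : ℝ)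
    (g : c.metrics) : TractorInScale (γ t) :=
  Φ g (γ t) • lift c g γ (κ g) t

namespace IsKappaFamily

lemma lift_eq (hκ : IsKappaFamily c γ I κ) (hγ : IsRegularOn γ I) (ht : t ∈ I)
    {g g' : c.metrics} {Ω : M → ℝ} (h : IsRescaling g.1 g'.1 Ω) :
    lift c g' γ (κ g') t = (Ω (γ t))⁻¹ • rescale g.1 Ω (γ t) (lift c g γ (κ g) t) :=
  lift_rescale h hγ ht (hκ.rescaling g g' Ω h t ht)

theorem lift_mem (hκ : IsKappaFamily c γ I κ) (hγ : IsRegularOn γ I) (ht : t ∈ I) :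
    (fun g => lift c g γ (κ g) t) ∈ AdjointTractor c (-1) (γ t) := fun _ _ Ω h => by
  rw [zpow_neg_one]
  exact hκ.lift_eq hγ ht h

theorem isDensity_loxodromeExpr (hκ : IsKappaFamily c γ I κ) (hγ : IsRegularOn γ I)
    (ht : t ∈ I) : IsDensity c (-2) (γ t) (fun g => loxodromeExpr c g γ (κ g) t) :=
  fun g g' Ω h => by
    rw [zpow_neg, zpow_ofNat]
    exact loxodromeExpr_rescale h hγ ht (hκ.smooth g t ht) (hκ.smooth g' t ht)
      (hκ.rescaling g g' Ω h)

variable {g₀ : c.metrics} {Φ : c.metrics → M → ℝ}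

/-- The lift has weight `-1`; the factors `Φ g`, a positive density of weight `1` along the curve,
correct it to weight `0`. -/
lemma generator_mem (hκ : IsKappaFamily c γ I κ) (hγ : IsRegularOn γ I) (ht : t ∈ I)
    (hΦ : ∀ g, IsRescaling g₀.1 g.1 (Φ g)) :
    generator γ κ Φ t ∈ canonicalLine c γ κ 0 t := by
  refine mem_canonicalLine.2 ⟨fun g g' Ω h => ?_, fun g => ⟨_, rfl⟩⟩
  -- The cocycle relation is found by computing the speed in `g'` both directly from `g₀` and
  -- through `g`.
  have hmul : Φ g' (γ t) = Ω (γ t) * Φ g (γ t) := by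
    have h1 := h.speed_eq γ t
    rw [(hΦ g).speed_eq, (hΦ g').speed_eq, ← mul_assoc] at h1
    exact mul_right_cancel₀ (speed_pos g₀.1 (hγ.velocity_ne_zero t ht)).ne' h1
  simp only [generator]
  rw [hκ.lift_eq hγ ht h, hmul, zpow_zero, one_smul, rescale_smul, smul_smul]
  congr 1
  have := (h.pos (γ t)).ne'
  field_simp

/-- Recovers the coefficient of a section of the line from its first slot, whence the coefficient of
a smooth section is smooth. -/
lemma lift_fst_apply (hγ : IsRegularOn γ I) (ht : t ∈ I) (g : c.metrics) (a : ℝ) (k : ℝ → ℝ) :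
    (a • lift c g γ k t).1 (unitTangent g.1 γ t) = a := by
  have h := hγ.tangentForm_unitTangent ht g.1
  change a * tangentForm g.1 γ t (unitTangent g.1 γ t) = a
  rw [h, mul_one]

lemma exists_smul_generator_eq (hκ : IsKappaFamily c γ I κ) (hγ : IsRegularOn γ I) (ht : t ∈ I)
    (hΦ : ∀ g, IsRescaling g₀.1 g.1 (Φ g)) {s : c.metrics → TractorInScale (γ t)}
    (hs : s ∈ canonicalLine c γ κ 0 t) : ∃ a : ℝ, a • generator γ κ Φ t = s := by
  obtain ⟨hs1, hs2⟩ := mem_canonicalLine.1 hs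
  obtain ⟨a, ha⟩ := hs2 g₀
  refine ⟨a, funext fun g => ?_⟩
  change a • generator γ κ Φ t g = s g
  rw [hs1 _ g _ (hΦ g), zpow_zero, one_smul, ← ha, rescale_smul, generator,
    hκ.lift_eq hγ ht (hΦ g), smul_smul (Φ g (γ t)), mul_inv_cancel₀ ((hΦ g).pos _).ne', one_smul]

/-- The transformation law determines a tractor from its value in one metric, so the fibre is
spanned by a `generator`. -/
theorem finrank_canonicalLine (hκ : IsKappaFamily c γ I κ) (hγ : IsRegularOn γ I) (ht : t ∈ I) :
    Module.finrank ℝ (canonicalLine c γ κ 0 t) = 1 := by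
  obtain ⟨g₀⟩ : Nonempty c.metrics := c.nonempty.to_subtype
  choose Φ hΦ using fun g => exists_rescaling g₀ g
  have hspan : canonicalLine c γ κ 0 t = Submodule.span ℝ {generator γ κ Φ t} := by
    refine le_antisymm (fun s hs => ?_) ?_
    · exact Submodule.mem_span_singleton.2 (hκ.exists_smul_generator_eq hγ ht hΦ hs)
    · rw [Submodule.span_singleton_le_iff_mem]
      exact hκ.generator_mem hγ ht hΦ
  rw [hspan]
  refine finrank_span_singleton fun h => ?_
  have h1 : generator γ κ Φ t g₀ = 0 := congrFun h _
  have h2 := lift_fst_apply hγ ht g₀ (Φ g₀ (γ t)) (κ g₀)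
  rw [generator] at h1
  rw [h1] at h2
  exact ((hΦ g₀).pos (γ t)).ne h2

lemma generator_isSmoothSection (hκ : IsKappaFamily c γ I κ) (hγ : IsRegularOn γ I)
    (hΦ : ∀ g, IsRescaling g₀.1 g.1 (Φ g)) : IsSmoothSection c γ I (generator γ κ Φ) := by
  intro g t ht
  have hU := hγ.tangentForm_smoothAt ht g.1
  have hA := hγ.acceleration_smoothAt ht g.1
  have hJ : CovectorSmoothAt γ (jerk c g γ) t := hγ.jerk_smoothAt c g ht
  have hf := (hΦ g).factor_smoothAt hγ ht
  have hk := hκ.smooth g t ht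
  have hcoef : ContDiffAt ℝ ∞ (fun r => 1 / 2 * (accelerationSq g.1 γ r - κ g r ^ 2)) t :=
    contDiffAt_const.mul ((hγ.accelerationSq_smoothAt ht g.1).sub (hk.pow 2))
  exact ⟨CovectorSmoothAt.smul hf hU, hf.smul (wedge_smoothAt hU hA), hf.mul hk,
    CovectorSmoothAt.smul hf ((hJ.add (CovectorSmoothAt.smul hcoef hU)).add
      (CovectorSmoothAt.smul hk hA))⟩

theorem loxodromeExpr_eq_zero (hκ : IsKappaFamily c γ I κ) (hγ : IsRegularOn γ I)
    (hp : IsPreserved c γ I κ) (g : c.metrics) (ht : t ∈ I) :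
    loxodromeExpr c g γ (κ g) t = 0 := by
  choose Φ hΦ using fun g' => exists_rescaling g g'
  obtain ⟨b, hb⟩ := (mem_canonicalLine.1 (hp _ (hκ.generator_isSmoothSection hγ hΦ)
    (fun r hr => hκ.generator_mem hγ hr hΦ) t ht)).2 g
  have hd := dTractor_smul_lift g hγ ht ((hΦ g).factor_smoothAt hγ ht) (hκ.smooth g t ht)
    (hκ.defines g t ht)
  have hb' := hb.trans hd
  -- The error term has first slot `0` and third slot `1`. The first slot evaluated on `U` fixes
  -- `b`, and the third then reads `b κ = b κ + Φ L` with `Φ > 0`.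
  have h1 := congrArg (fun s : TractorInScale (γ t) => s.1 (unitTangent g.1 γ t)) hb'
  have h2 := congrArg (fun s : TractorInScale (γ t) => s.2.2.1) hb'
  simp only [Prod.fst_add, add_apply, lift_fst_apply hγ ht] at h1
  simp only [Prod.snd_add, Prod.fst_add, Prod.smul_snd, Prod.smul_fst, smul_zero,
    zero_apply, add_zero, smul_eq_mul, mul_one] at h1 h2
  rw [← h1, left_eq_add] at h2
  exact (mul_eq_zero.1 h2).resolve_left ((hΦ g).pos _).ne'

/-- Invariance of the tractor connection on arbitrary sections is not needed. From `a' = Ω a` and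
the law for `κ`, the `Υ(U)` terms cancel in `∂a - κ a`, so the image has the weight `-1` of the
lift. -/
theorem isPreserved (hκ : IsKappaFamily c γ I κ) (hγ : IsRegularOn γ I)
    (h0 : ∀ g, ∀ t ∈ I, loxodromeExpr c g γ (κ g) t = 0) : IsPreserved c γ I κ := by
  intro s hs hline t ht
  let a : c.metrics → ℝ → ℝ := fun g r => (s r g).1 (unitTangent g.1 γ r)
  have hsa : ∀ g, ∀ r ∈ I, s r g = a g r • lift c g γ (κ g) r := by
    intro g r hr
    obtain ⟨b, hb⟩ := (mem_canonicalLine.1 (hline r hr)).2 g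
    have hab : a g r = b := by
      simp only [a, ← hb, lift_fst_apply hγ hr]
    rw [hab, hb]
  have has : ∀ g, ContDiffAt ℝ ∞ (a g) t := fun g =>
    hγ.apply_smoothAt ht (α := fun r => (s r g).1) (hs g t ht).1
      (hγ.unitTangent_smoothAt ht g.1)
  have hd : ∀ g, dTractor c g γ (fun r => s r g) t
      = (dFun g.1 γ (a g) t - κ g t * a g t) • lift c g γ (κ g) t := by
    intro g
    rw [dTractor_congr g (mem_of_superset (hγ.mem_nhds ht) (hsa g)),
      dTractor_smul_lift g hγ ht (has g) (hκ.smooth g t ht) (hκ.defines g t ht), h0 g t ht,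
      mul_zero, zero_smul, add_zero]
  refine mem_canonicalLine.2 ⟨fun g g' Ω h => ?_, fun g => ⟨_, (hd g).symm⟩⟩
  have hΩ := (h.pos (γ t)).ne'
  have haΩ : ∀ r ∈ I, a g' r = Ω (γ r) * a g r := by
    intro r hr
    have h1 := (mem_canonicalLine.1 (hline r hr)).1 g g' Ω h
    have h2 : (s r g').1 = Ω (γ r) ^ 2 • (s r g).1 := by
      rw [h1, zpow_zero, one_smul]
      rfl
    have hr' := (h.pos (γ r)).ne'
    simp only [a, h2, h.unitTangent_eq, map_smul, smul_apply, smul_eq_mul]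
    field_simp
  have hda : dFun g'.1 γ (a g') t
      = upsilon Ω (γ t) (unitTangent g.1 γ t) * a g t + dFun g.1 γ (a g) t := by
    rw [h.dFun_eq, dFun_congr g.1 γ (mem_of_superset (hγ.mem_nhds ht) haΩ),
      dFun_mul g.1 γ (h.factor_smoothAt hγ ht) (has g), dFun_factor h g.1 hγ ht]
    field_simp
  simp only [hd]
  rw [hda, haΩ t ht, hκ.rescaling g g' Ω h t ht, hκ.lift_eq hγ ht h, rescale_smul, zpow_neg_one,
    smul_comm (Ω (γ t))⁻¹]
  congr 1
  field_simp
  ring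

theorem isPreserved_iff (hκ : IsKappaFamily c γ I κ) (hγ : IsRegularOn γ I) (g : c.metrics) :
    IsPreserved c γ I κ ↔ ∀ t ∈ I, loxodromeExpr c g γ (κ g) t = 0 := by
  refine ⟨fun hp t ht => hκ.loxodromeExpr_eq_zero hγ hp g ht, fun h => ?_⟩
  refine hκ.isPreserved hγ fun g' t ht => ?_
  -- Preservation involves all metrics at once; the weight `-2` law carries the vanishing from `g`
  -- to each `g'`.
  obtain ⟨Ω, hΩ⟩ := exists_rescaling g g'
  have h1 := hκ.isDensity_loxodromeExpr hγ ht g g' Ω hΩ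
  simp only [h t ht, mul_zero] at h1
  exact h1

end IsKappaFamily

end CanonicalLine

end Mobius

end

theorem mainTheorem1 {M : Type*} [TopologicalSpace M] [ChartedSpace Mobius.Plane M]
    [IsManifold (𝓡 2) ∞ M] (c : Mobius.MobiusStructure M)
    (I : Set ℝ) (hI : IsOpen I) (γ : ℝ → M)
    (hγ : ContMDiffOn 𝓘(ℝ, ℝ) (𝓡 2) ∞ γ I)
    (hγ' : ∀ t ∈ I, Mobius.velocity γ t ≠ 0)
    (hJ : ∃ g : c.metrics, ∀ t ∈ I, Mobius.jerk c g γ t ≠ 0) :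
    (∃ κ : c.metrics → ℝ → ℝ, Mobius.DefinesKappa c γ I κ ∧
      (∀ g, ContDiffOn ℝ ∞ (κ g) I) ∧
      ∀ κ', Mobius.DefinesKappa c γ I κ' → ∀ g, Set.EqOn (κ' g) (κ g) I) ∧
    ∀ κ : c.metrics → ℝ → ℝ, Mobius.DefinesKappa c γ I κ →
      (∀ t ∈ I, (fun g => Mobius.lift c g γ (κ g) t) ∈ Mobius.AdjointTractor c (-1) (γ t)) ∧
      (∀ t ∈ I, Module.finrank ℝ (Mobius.canonicalLine c γ κ 0 t) = 1) ∧
      (∀ t ∈ I, Mobius.IsDensity c (-2) (γ t) (fun g => Mobius.loxodromeExpr c g γ (κ g) t)) ∧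
      ∀ g : c.metrics, Mobius.IsPreserved c γ I κ ↔
        ∀ t ∈ I, Mobius.loxodromeExpr c g γ (κ g) t = 0 := by
  have hreg : Mobius.IsRegularOn γ I := ⟨hI, hγ, hγ'⟩
  obtain ⟨g₀, hg₀⟩ := hJ
  have hJ : ∀ (g : c.metrics), ∀ t ∈ I, Mobius.jerk c g γ t ≠ 0 := fun g t ht =>
    Mobius.jerk_ne_zero hreg hg₀ g ht
  refine ⟨⟨Mobius.kappa c γ, fun g t ht => Mobius.kappa_spec hreg ht (hJ g t ht),
    fun g t ht => (Mobius.kappa_smoothAt hreg ht (hJ g t ht)).contDiffWithinAt,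
    fun κ' hκ' g t ht => hκ'.eq_kappa hreg hJ g ht⟩, fun κ hκ => ?_⟩
  have hfam := hκ.isKappaFamily hreg hJ
  exact ⟨fun t ht => hfam.lift_mem hreg ht, fun t ht => hfam.finrank_canonicalLine hreg ht,
    fun t ht => hfam.isDensity_loxodromeExpr hreg ht, hfam.isPreserved_iff hreg⟩
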